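/- Let $n,N\in\mathbb N$, let $\Omega\subset\mathbb R^N$ be a bounded open set and $Y=Z=(-\tfrac12,\tfrac12)^N$. Let $B:[0,\infty)\to[0,\infty)$ be an N-function (continuous, convex, $B(t)>0$ for $t>0$, $B(t)/t\to0$ as $t\to0^+$, $B(t)/t\to\infty$ as $t\to\infty$) with complementary function $\widetilde B(t)=\sup_{s\ge0}\{st-B(s)\}$, and assume that $B$ and $\widetilde B$ both satisfy the $\Delta_2$ condition: there are $\alpha>0$, $t_0\ge0$ (possibly different for the two functions) such that $B(2t)\le\alpha B(t)$, respectively $\widetilde B(2t)\le\alpha\widetilde B(t)$, for all $t\ge t_0$. For a measurable set $A$, $L^B(A)$ is the space of measurable $u:A\to\mathbb R$ with $\lim_{\delta\to0^+}\int_A B(\delta|u|)=0$. $L^B_{per}(Y\times Z)$ is the space of $Y\times Z$-periodic functions in $L^B_{loc}(\mathbb R^N\times\mathbb R^N)$, and $L^B_{per}(\Omega\times Y\times Z)$ is the space of $u\in L^B_{loc}(\Omega\times\mathbb R^N\times\mathbb R^N)$ with $u(x,\cdot,\cdot)\in L^B_{per}(Y\times Z)$ for a.e. $x\in\Omega$ and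 $\iiint_{\Omega\times Y\times Z}B(|u|)\,dx\,dy\,dz<\infty$. $\mathcal C_{per}(Y\times Z)$ is the space of continuous functions on $\mathbb R^N\times\mathbb R^N$ that are $\mathbb Z^N\times\mathbb Z^N$-periodic, with the supremum norm, and $L^{\widetilde B}(\Omega;\mathcal C_{per}(Y\times Z))$ is the space of strongly measurable $\varphi:\Omega\to\mathcal C_{per}(Y\times Z)$ with $x\mapsto\|\varphi(x)\|_\infty$ in $L^{\widetilde B}(\Omega)$. Let $f:\mathbb R^N\times\mathbb R^N\times\mathbb R^{nN}\to[0,\infty)$ satisfy: - $(H_1)$ for all $\lambda$: $f(\cdot,z,\lambda)$ is measurable for all $z$, and $f(y,\cdot,\lambda)$ is continuous for a.e. $y$; - $(H_2)$ $f(y,z,\cdot)$ is strictly convex for a.e. $y$ and all $z$; - $(H_3)$ for all $k,k'\in\mathbb Z^N$ and all $(z,\lambda)$: $f(y+k,z+k',\lambda)=f(y,z,\lambda)$ for a.e. $y$; - $(H_4)$ there are $c_1,c_2>0$ such that for all $\lambda$, for a.e. $y$ and all $z$: $c_1B(|\lambda|)\le f(y,z,\lambda)\le c_2(1+B(|\lambda|))$.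 For each integer $m\ge1$ let $\theta_m\in C_c^\infty(\mathbb R^{nN})$ be a symmetric mollifier: $\theta_m\ge0$, $\theta_m(-\eta)=\theta_m(\eta)$, $\operatorname{supp}\theta_m\subset\frac1m\overline B(0,1)$, $\int\theta_m=1$; and put $$f_m(y,z,\lambda)=\int_{\mathbb R^{nN}}\theta_m(\eta)\,f(y,z,\lambda-\eta)\,d\eta .$$ Let $\varepsilon$ range over a sequence of positive numbers converging to $0$, and let $(v_\varepsilon)\subset L^B(\Omega)^{nN}$ converge weakly reiteratively two-scale, in each component, to $v\in L^B_{per}(\Omega\times Y\times Z)^{nN}$; that is, for every component $j$ and every $\varphi\in L^{\widetilde B}(\Omega;\mathcal C_{per}(Y\times Z))$, $$\int_\Omega v_\varepsilon^j(x)\,\varphi\Big(x,\frac x\varepsilon,\frac x{\varepsilon^2}\Big)dx\;\longrightarrow\;\iiint_{\Omega\times Y\times Z}v^j\,\varphi\,dx\,dy\,dz .$$ Then the functions $x\mapsto f(\frac x\varepsilon,\frac x{\varepsilon^2},v_\varepsilon(x))$ are integrable on $\Omega$, the functions $(x,y,z)\mapsto f_m(y,z,v(x,y,z))$, $m\ge1$,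 are integrable on $\Omega\times Y\times Z$, and there is a constant $C'$, independent of $m$, such that for every integer $m\ge1$ $$\iiint_{\Omega\times Y\times Z}f_m(y,z,v(x,y,z))\,dx\,dy\,dz-\frac{C'}m\;\le\;\liminf_{\varepsilon\to0}\int_\Omega f\Big(\frac x\varepsilon,\frac x{\varepsilon^2},v_\varepsilon(x)\Big)dx .$$ -/

import Mathlib

open MeasureTheory Filter Topology Set
open scoped ContDiff

/-- The Euclidean space `ℝ^d`. -/
abbrev RSpace (d : ℕ) : Type := EuclideanSpace ℝ (Fin d)

/-! ### N-functions -/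

/-- `B` is an N-function. Only the restriction of `B` to `[0, ∞)` matters; the conditions force
`B 0 = 0` and `B ≥ 0` on `[0, ∞)`. -/
structure IsNFunction (B : ℝ → ℝ) : Prop where
  continuousOn : ContinuousOn B (Ici 0)
  convexOn : ConvexOn ℝ (Ici 0) B
  pos : ∀ t, 0 < t → 0 < B t
  tendsto_zero : Tendsto (fun t => B t / t) (𝓝[>] 0) (𝓝 0)
  tendsto_top : Tendsto (fun t => B t / t) atTop atTop

/-- The complementary function `t ↦ sup_{s ≥ 0} (s t - B s)`; for an N-function the supremum is
finite. -/
noncomputable def complementaryFun (B : ℝ → ℝ) (t : ℝ) : ℝ :=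
  sSup ((fun s : ℝ => s * t - B s) '' Ici 0)

/-- The `Δ₂` condition (at infinity). -/
def DeltaTwo (B : ℝ → ℝ) : Prop :=
  ∃ α : ℝ, 0 < α ∧ ∃ t₀ : ℝ, 0 ≤ t₀ ∧ ∀ t, t₀ ≤ t → B (2 * t) ≤ α * B t

/-! ### Orlicz spaces -/

/-- Membership of a real function in the Orlicz space `L^B(μ)`; `L^B(A)` is the case
`μ = volume.restrict A`. -/
def MemOrlicz {α : Type*} [MeasurableSpace α] (B : ℝ → ℝ) (μ : Measure α) (u : α → ℝ) : Prop :=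
  AEStronglyMeasurable u μ ∧
    Tendsto (fun δ : ℝ => ∫⁻ x, ENNReal.ofReal (B (δ * |u x|)) ∂μ) (𝓝[>] 0) (𝓝 0)

/-- The vector of `ℝ^N` with integer coordinates `k`. -/
noncomputable def intVec {N : ℕ} (k : Fin N → ℤ) : RSpace N :=
  WithLp.toLp 2 (fun i => (k i : ℝ))

/-- The cube `(-1/2, 1/2)^N`, which serves both as `Y` and as `Z`. -/
def unitCube (N : ℕ) : Set (RSpace N) := {y | ∀ i, y i ∈ Ioo (-1 / 2 : ℝ) (1 / 2)}

/-- `L^B_per(Y × Z)`: functions in `L^B_loc(ℝ^N × ℝ^N)` that are `Y × Z`-periodic. -/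
structure MemOrliczPer {N : ℕ} (B : ℝ → ℝ) (w : RSpace N × RSpace N → ℝ) : Prop where
  loc : ∀ K : Set (RSpace N × RSpace N), IsCompact K → MemOrlicz B (volume.restrict K) w
  periodic : ∀ k h : Fin N → ℤ,
    ∀ᵐ q : RSpace N × RSpace N, w (q.1 + intVec k, q.2 + intVec h) = w q

/-- `L^B_per(Ω × Y × Z)`. -/
structure MemOrliczPerOn {N : ℕ} (B : ℝ → ℝ) (Ω : Set (RSpace N))
    (u : RSpace N × RSpace N × RSpace N → ℝ) : Prop where
  loc : ∀ K : Set (RSpace N × RSpace N × RSpace N), IsCompact K → K ⊆ Ω ×ˢ univ →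
    MemOrlicz B (volume.restrict K) u
  periodic : ∀ᵐ x ∂(volume.restrict Ω), MemOrliczPer B (fun q => u (x, q))
  finite : ∫⁻ p in Ω ×ˢ (unitCube N ×ˢ unitCube N), ENNReal.ofReal (B |u p|) < ⊤

/-- Membership in `C_per(Y × Z)`, realised as a closed subspace of the bounded continuous
functions on `ℝ^N × ℝ^N` with the supremum norm. -/
def IsCPer {N : ℕ} (w : BoundedContinuousFunction (RSpace N × RSpace N) ℝ) : Prop :=
  ∀ (k h : Fin N → ℤ) (y z : RSpace N), w (y + intVec k, z + intVec h) = w (y, z)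

/-- `L^B(Ω; C_per(Y × Z))`: strongly measurable maps `φ` whose norm `x ↦ ‖φ x‖_∞` belongs to
`L^B(Ω)`. -/
structure MemOrliczCPer {N : ℕ} (B : ℝ → ℝ) (Ω : Set (RSpace N))
    (φ : RSpace N → BoundedContinuousFunction (RSpace N × RSpace N) ℝ) : Prop where
  meas : AEStronglyMeasurable φ (volume.restrict Ω)
  periodic : ∀ᵐ x ∂(volume.restrict Ω), IsCPer (φ x)
  norm_mem : MemOrlicz B (volume.restrict Ω) (fun x => ‖φ x‖)

/-! ### Weak reiterated two-scale convergence -/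

/-- `u k ⇀ u₀` weakly reiteratively two-scale in `L^B(Ω)` along the scales `ε k → 0`. -/
structure WeakReitTwoScale {N : ℕ} (B : ℝ → ℝ) (Ω : Set (RSpace N)) (ε : ℕ → ℝ)
    (u : ℕ → RSpace N → ℝ) (u₀ : RSpace N × RSpace N × RSpace N → ℝ) : Prop where
  mem : ∀ k, MemOrlicz B (volume.restrict Ω) (u k)
  limit_mem : MemOrliczPerOn B Ω u₀
  tendsto : ∀ φ : RSpace N → BoundedContinuousFunction (RSpace N × RSpace N) ℝ,
    MemOrliczCPer (complementaryFun B) Ω φ →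
    Tendsto
      (fun k => ∫ x in Ω, u k x * φ x ((ε k)⁻¹ • x, ((ε k) ^ 2)⁻¹ • x))
      atTop
      (𝓝 (∫ p in Ω ×ˢ (unitCube N ×ˢ unitCube N), u₀ p * φ p.1 p.2))

/-! ### Integrands -/

/-- The hypotheses on the integrand `f : ℝ^N × ℝ^N × ℝ^d → [0, ∞)`: it is measurable in `y` and
continuous in `z`, strictly convex in `l`, periodic in `(y, z)`, and has `B`-growth. -/
structure IsIntegrand {N d : ℕ} (B : ℝ → ℝ) (f : RSpace N → RSpace N → RSpace d → ℝ) :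
    Prop where
  nonneg : ∀ y z l, 0 ≤ f y z l
  measurable : ∀ l z, AEMeasurable (fun y => f y z l)
  continuous : ∀ l, ∀ᵐ y, Continuous (fun z => f y z l)
  strictConvex : ∀ᵐ y, ∀ z, StrictConvexOn ℝ univ (fun l => f y z l)
  periodic : ∀ k h : Fin N → ℤ, ∀ z l, ∀ᵐ y, f (y + intVec k) (z + intVec h) l = f y z l
  growth : ∃ c₁ c₂ : ℝ, 0 < c₁ ∧ 0 < c₂ ∧ ∀ l, ∀ᵐ y, ∀ z,
    c₁ * B ‖l‖ ≤ f y z l ∧ f y z l ≤ c₂ * (1 + B ‖l‖)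

/-- `θ` is a symmetric mollifier of radius `1/m` on `ℝ^d`. -/
structure IsSymmMollifier {d : ℕ} (m : ℕ) (θ : RSpace d → ℝ) : Prop where
  smooth : ContDiff ℝ ∞ θ
  nonneg : ∀ η, 0 ≤ θ η
  symm : ∀ η, θ (-η) = θ η
  support : tsupport θ ⊆ Metric.closedBall 0 (1 / (m : ℝ))
  integral_eq_one : ∫ η, θ η = 1

/-- The integrand `f` mollified by `θ` in its last variable. -/
noncomputable def mollifiedIntegrand {N d : ℕ} (θ : RSpace d → ℝ)
    (f : RSpace N → RSpace N → RSpace d → ℝ) (y z : RSpace N) (l : RSpace d) : ℝ :=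
  ∫ η, θ η * f y z (l - η)

/-!
The mollified integrands satisfy `f_m ≤ f + c₂ (1 + B (1 + |λ|)) / m`: convexity along the segment
from `λ` to `λ - m η` turns a shift by `η`, `|η| ≤ 1/m`, into a gain of a factor `1/m`
(`IsTorusIntegrand.mollified_le`). It is therefore enough to prove lower semicontinuity for `f`
itself, `∭ f(y, z, v) ≤ liminf ∫ f(x/ε, x/ε², v_ε)`, and then `C' = c₂ ∭ (1 + B (1 + |v|))` works.

After removal of null sets the integrand lives on the torus (`exists_isTorusIntegrand`). Since `f` is
only measurable in `y`, its subgradients are not admissible test functions. They are avoided by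
bounding `f` below by countably many affine functions `η (z) (q · λ - a (y))` with constant slope `q`
and a continuous cut-off `η` to a small ball of values of `z`; the constant `a (y)`, a conjugate of
`f` localised in `z`, depends on `y` alone, and the supremum of these minorants is `f`
(`IsTorusIntegrand.exists_lt_localMinorant`).

For finitely many such minorants `h_i` and continuous periodic weights `χ_i ≥ 0`, `∑ χ_i ≤ 1`, one has
`f ≥ ∑ χ_i h_i` because `f ≥ 0`. The terms `χ_i η_i q_i · v_ε` converge by the hypothesis, as
`χ_i η_i q_i` is admissible, and the terms `χ_i η_i a_i (x/ε)` converge by a mean value property for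
products of a bounded measurable function of `x/ε` with a continuous function of `(x, x/ε, x/ε²)`
(`tendsto_setIntegral_mul_scalePoint`), proved by averaging over the translations `ε r + ε² s`. Hence
`∭ ∑ χ_i h_i` is at most the lower limit (`IsTorusIntegrand.mixture_le_liminf`). Optimising over the
weights gives the same bound for `∭ max_i h_i` (`integral_le_of_forall_mixture_le`), and monotone
convergence gives it for `∭ f`.
-/

/-! ### The flat torus -/

/-- The flat torus `ℝ^N / ℤ^N`, with its product Haar probability measure. -/
abbrev Torus (N : ℕ) : Type := Fin N → UnitAddCircle

/-- The covering map `ℝ^N → ℝ^N / ℤ^N`. -/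
def toTorus {N : ℕ} (y : RSpace N) : Torus N := fun i => (y i : UnitAddCircle)

lemma continuous_toTorus {N : ℕ} : Continuous (toTorus : RSpace N → Torus N) :=
  continuous_pi fun i => (AddCircle.continuous_mk' 1).comp (by fun_prop)

lemma isOpenMap_toTorus {N : ℕ} : IsOpenMap (toTorus : RSpace N → Torus N) := by
  have h : IsOpenMap (Pi.map fun (_ : Fin N) (t : ℝ) => (t : UnitAddCircle)) :=
    IsOpenMap.piMap (fun _ => QuotientAddGroup.isOpenMap_coe)
      (Filter.Eventually.of_forall fun _ => QuotientAddGroup.mk_surjective)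
  exact h.comp (PiLp.homeomorph 2 (fun _ : Fin N => ℝ)).isOpenMap

lemma toTorus_add {N : ℕ} (y y' : RSpace N) : toTorus (y + y') = toTorus y + toTorus y' := by
  ext i; simp [toTorus]

lemma toTorus_intVec {N : ℕ} (k : Fin N → ℤ) : toTorus (intVec k) = 0 := by
  ext i
  simp [toTorus, intVec]

lemma toTorus_add_intVec {N : ℕ} (y : RSpace N) (k : Fin N → ℤ) :
    toTorus (y + intVec k) = toTorus y := by
  rw [toTorus_add, toTorus_intVec, add_zero]

lemma exists_eq_add_intVec {N : ℕ} {y y' : RSpace N} (h : toTorus y = toTorus y') :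
    ∃ k : Fin N → ℤ, y = y' + intVec k := by
  have h' : ∀ i, ∃ k : ℤ, (k : ℝ) = y i - y' i := fun i => by
    have h1 : ((y i - y' i : ℝ) : UnitAddCircle) = 0 := by
      rw [AddCircle.coe_sub, sub_eq_zero]; exact congrFun h i
    obtain ⟨k, hk⟩ := (AddCircle.coe_eq_zero_iff 1).1 h1
    exact ⟨k, by simpa using hk⟩
  choose k hk using h'
  refine ⟨k, ?_⟩
  ext i
  simp [intVec, hk]

/-- The measurable section of `toTorus` with values in the half-open cube `(-1/2, 1/2]^N`. -/
noncomputable def torusSection {N : ℕ} (t : Torus N) : RSpace N :=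
  WithLp.toLp 2 fun i => (AddCircle.equivIoc 1 (-1 / 2) (t i) : ℝ)

lemma measurable_torusSection {N : ℕ} : Measurable (torusSection : Torus N → RSpace N) := by
  refine (MeasurableEquiv.toLp 2 (Fin N → ℝ)).measurable.comp (measurable_pi_lambda _ fun i => ?_)
  exact measurable_subtype_coe.comp
    ((AddCircle.measurableEquivIoc 1 (-1 / 2)).measurable.comp (measurable_pi_apply i))

lemma toTorus_torusSection {N : ℕ} (t : Torus N) : toTorus (torusSection t) = t := by
  ext i
  exact AddCircle.coe_equivIoc

lemma surjective_toTorus {N : ℕ} : Function.Surjective (toTorus : RSpace N → Torus N) :=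
  fun t => ⟨_, toTorus_torusSection t⟩

lemma isOpen_unitCube (N : ℕ) : IsOpen (unitCube N) := by
  have : unitCube N = ⋂ i, (fun y : RSpace N => y i) ⁻¹' Ioo (-1 / 2) (1 / 2) := by
    ext y; simp [unitCube]
  rw [this]
  exact isOpen_iInter_of_finite fun i => isOpen_Ioo.preimage (by fun_prop)

lemma injOn_toTorus {N : ℕ} : InjOn (toTorus : RSpace N → Torus N) (unitCube N) := by
  intro y hy y' hy' h
  ext i
  have h0 := AddCircle.coe_eq_coe_iff_of_mem_Ico (p := (1 : ℝ)) (a := -1 / 2) (x := y i) (y := y' i)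
  refine (h0 ?_ ?_).1 (congrFun h i)
  · have := hy i; constructor <;> linarith [this.1, this.2]
  · have := hy' i; constructor <;> linarith [this.1, this.2]

lemma measurePreserving_toTorus (N : ℕ) :
    MeasurePreserving (toTorus : RSpace N → Torus N) (volume.restrict (unitCube N)) volume := by
  have h1 : MeasurePreserving (fun (x : Fin N → ℝ) => (fun i => (x i : UnitAddCircle) : Torus N))
      (Measure.pi fun _ => volume.restrict (Ioc (-1 / 2 : ℝ) (-1 / 2 + 1)))
      (Measure.pi fun _ => volume) :=
    measurePreserving_pi _ _ fun i => AddCircle.measurePreserving_mk 1 (-1 / 2)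
  have h2 : (Measure.pi fun _ : Fin N => (volume : Measure ℝ).restrict (Ioc (-1 / 2 : ℝ) (-1 / 2 + 1)))
      = (volume : Measure (Fin N → ℝ)).restrict (univ.pi fun _ => Ioo (-1 / 2 : ℝ) (1 / 2)) := by
    have : (volume : Measure ℝ).restrict (Ioc (-1 / 2 : ℝ) (-1 / 2 + 1))
        = volume.restrict (Ioo (-1 / 2 : ℝ) (1 / 2)) := by
      norm_num
      exact (Measure.restrict_congr_set Ioo_ae_eq_Ioc).symm
    rw [this, volume_pi, Measure.restrict_pi_pi]
  rw [h2] at h1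
  have h3 := (PiLp.volume_preserving_ofLp (Fin N)).restrict_preimage
    (s := univ.pi fun _ => Ioo (-1 / 2 : ℝ) (1 / 2))
    (MeasurableSet.univ_pi fun _ => measurableSet_Ioo)
  have h4 : (WithLp.ofLp ⁻¹' (univ.pi fun _ : Fin N => Ioo (-1 / 2 : ℝ) (1 / 2)) : Set (RSpace N))
      = unitCube N := by
    ext y; simp [unitCube, Set.mem_pi]
  rw [h4] at h3
  exact h1.comp h3

instance (N : ℕ) : IsProbabilityMeasure (volume : Measure (Torus N)) :=
  ⟨by rw [volume_pi, Measure.pi_univ]; simp⟩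

lemma volume_unitCube (N : ℕ) : volume (unitCube N) = 1 := by
  have h := (measurePreserving_toTorus N).measure_preimage MeasurableSet.univ.nullMeasurableSet
  rwa [preimage_univ, Measure.restrict_apply_univ, measure_univ] at h

lemma norm_le_of_mem_unitCube {N : ℕ} {y : RSpace N} (hy : y ∈ unitCube N) : ‖y‖ ≤ N := by
  calc ‖y‖ ≤ ∑ i, ‖y i‖ := by
        have : y = ∑ i, EuclideanSpace.single i (y i) := by
          ext j; simp [Finset.sum_apply]
        conv_lhs => rw [this]
        refine (norm_sum_le _ _).trans (Finset.sum_le_sum fun i _ => by simp)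
    _ ≤ ∑ _i : Fin N, (1 : ℝ) := Finset.sum_le_sum fun i _ => by
        have := hy i
        rw [Real.norm_eq_abs, abs_le]; constructor <;> linarith [this.1, this.2]
    _ = N := by simp

/-! ### Mean values of oscillating functions -/

/-- The point `(x, x/ε, x/ε²)` of the reiterated two-scale space `ℝ^N × (ℝ^N/ℤ^N)²`. -/
noncomputable def scalePoint {N : ℕ} (ε : ℝ) (x : RSpace N) : RSpace N × Torus N × Torus N :=
  (x, toTorus (ε⁻¹ • x), toTorus ((ε ^ 2)⁻¹ • x))

lemma continuous_scalePoint {N : ℕ} (ε : ℝ) :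
    Continuous (scalePoint ε : RSpace N → RSpace N × Torus N × Torus N) :=
  continuous_id.prodMk ((continuous_toTorus.comp (by fun_prop)).prodMk
    (continuous_toTorus.comp (by fun_prop)))

lemma scalePoint_add {N : ℕ} {ε : ℝ} (hε : 0 < ε) (x r s : RSpace N) :
    scalePoint ε (x + (ε • r + ε ^ 2 • s)) =
      (x + (ε • r + ε ^ 2 • s), toTorus (ε⁻¹ • x) + toTorus r + toTorus (ε • s),
        toTorus ((ε ^ 2)⁻¹ • x) + toTorus (ε⁻¹ • r) + toTorus s) := by
  have h1 : ε⁻¹ • (x + (ε • r + ε ^ 2 • s)) = ε⁻¹ • x + r + ε • s := by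
    simp only [smul_add, smul_smul, ← add_assoc]
    congr 2
    · rw [inv_mul_cancel₀ hε.ne', one_smul]
    · field_simp
  have h2 : (ε ^ 2)⁻¹ • (x + (ε • r + ε ^ 2 • s)) = (ε ^ 2)⁻¹ • x + ε⁻¹ • r + s := by
    simp only [smul_add, smul_smul, ← add_assoc]
    congr 2
    · field_simp
    · rw [inv_mul_cancel₀ (by positivity), one_smul]
  simp only [scalePoint, h1, h2, toTorus_add]

instance (N : ℕ) : IsProbabilityMeasure ((volume : Measure (RSpace N)).restrict (unitCube N)) :=
  ⟨by rw [Measure.restrict_apply_univ, volume_unitCube]⟩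

lemma integral_unitCube_toTorus_add {N : ℕ} {g : Torus N → ℝ} (hg : Measurable g) (t : Torus N) :
    ∫ s in unitCube N, g (t + toTorus s) = ∫ t', g t' := by
  have h := (measurePreserving_toTorus N).map_eq
  rw [← integral_add_left_eq_self g t, ← h, integral_map continuous_toTorus.aemeasurable]
  exact (hg.comp (measurable_const_add t)).aestronglyMeasurable

lemma lintegral_unitCube_toTorus_add {N : ℕ} {g : Torus N → ENNReal} (hg : Measurable g)
    (t : Torus N) : ∫⁻ s in unitCube N, g (t + toTorus s) = ∫⁻ t', g t' := by
  have h := (measurePreserving_toTorus N).map_eq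
  rw [← lintegral_add_left_eq_self g t, ← h, lintegral_map _ continuous_toTorus.measurable]
  exact hg.comp (measurable_const_add t)

/-- A periodic function sampled at `x/ε` has its integrals over balls controlled by its integral
over one period, uniformly in `ε ≤ 1`: average over the translations by `ε s`, `s` in the cube. -/
lemma lintegral_ball_comp_toTorus_le {N : ℕ} {e : Torus N → ENNReal} (he : Measurable e) {ε : ℝ}
    (hε : 0 < ε) (hε1 : ε ≤ 1) (R : ℝ) :
    ∫⁻ x in Metric.ball (0 : RSpace N) R, e (toTorus (ε⁻¹ • x)) ≤
      volume (Metric.ball (0 : RSpace N) (R + N)) * ∫⁻ t, e t := by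
  set I := ∫⁻ x in Metric.ball (0 : RSpace N) R, e (toTorus (ε⁻¹ • x)) with hI
  have hs : ∀ s ∈ unitCube N, I ≤
      ∫⁻ x in Metric.ball (0 : RSpace N) (R + N), e (toTorus (ε⁻¹ • x) + toTorus s) := by
    intro s hs
    rw [hI, ← lintegral_indicator Metric.isOpen_ball.measurableSet,
      ← lintegral_indicator Metric.isOpen_ball.measurableSet,
      ← lintegral_add_right_eq_self _ (ε • s)]
    refine lintegral_mono fun x => ?_
    have h1 : ε⁻¹ • (x + ε • s) = ε⁻¹ • x + s := by
      rw [smul_add, smul_smul, inv_mul_cancel₀ hε.ne', one_smul]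
    by_cases hx : x + ε • s ∈ Metric.ball (0 : RSpace N) R
    · have hx' : x ∈ Metric.ball (0 : RSpace N) (R + N) := by
        rw [mem_ball_zero_iff] at hx ⊢
        have h2 : ‖ε • s‖ ≤ N := by
          rw [norm_smul, Real.norm_of_nonneg hε.le]
          exact (mul_le_of_le_one_left (norm_nonneg _) hε1).trans (norm_le_of_mem_unitCube hs)
        have h3 := norm_le_add_norm_add x (ε • s)
        linarith
      simp only [indicator_of_mem hx, indicator_of_mem hx', h1, toTorus_add, le_refl]
    · rw [indicator_of_notMem hx]; exact zero_le
  calc I = ∫⁻ _s in unitCube N, I := by simp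
    _ ≤ ∫⁻ s in unitCube N,
        ∫⁻ x in Metric.ball (0 : RSpace N) (R + N), e (toTorus (ε⁻¹ • x) + toTorus s) :=
      setLIntegral_mono' (isOpen_unitCube N).measurableSet hs
    _ = ∫⁻ x in Metric.ball (0 : RSpace N) (R + N),
        ∫⁻ s in unitCube N, e (toTorus (ε⁻¹ • x) + toTorus s) := by
      refine lintegral_lintegral_swap (Measurable.aemeasurable ?_)
      exact he.comp ((continuous_toTorus.comp (by fun_prop)).add
        (continuous_toTorus.comp (by fun_prop))).measurable
    _ = volume (Metric.ball (0 : RSpace N) (R + N)) * ∫⁻ t, e t := by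
      simp [lintegral_unitCube_toTorus_add he, mul_comm]

lemma exists_ball_of_hasCompactSupport {N : ℕ} {G : RSpace N × Torus N × Torus N → ℝ}
    (hGs : HasCompactSupport G) : ∃ R : ℝ, 0 < R ∧ ∀ x t, R ≤ ‖x‖ → G (x, t) = 0 := by
  obtain ⟨R, hR⟩ := (hGs.isCompact.image continuous_fst).isBounded.subset_ball 0
  refine ⟨max R 1, by positivity, fun x t hx => ?_⟩
  by_contra h
  have h1 := hR ⟨(x, t), subset_tsupport _ h, rfl⟩
  rw [mem_ball_zero_iff] at h1
  exact absurd (le_max_left R 1) (by simp only at h1; linarith)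

lemma eventually_small_translations {N : ℕ} {η : ℝ} (hη : 0 < η) :
    ∀ᶠ ε : ℝ in 𝓝[>] 0, 0 < ε ∧ ∀ r ∈ unitCube N, ∀ s ∈ unitCube N,
      ‖ε • r + ε ^ 2 • s‖ < min η 1 ∧ ‖toTorus (ε • s)‖ < η := by
  have h1 : ∀ᶠ h : RSpace N in 𝓝 0, ‖toTorus h‖ < η := by
    have : Tendsto (fun h : RSpace N => ‖toTorus h‖) (𝓝 0) (𝓝 ‖toTorus (0 : RSpace N)‖) :=
      (continuous_toTorus.norm).tendsto 0
    have h0 : toTorus (0 : RSpace N) = 0 := by ext i; simp [toTorus]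
    rw [h0, norm_zero] at this
    exact this.eventually_lt_const hη
  obtain ⟨ρ, hρ, hρη⟩ := Metric.eventually_nhds_iff.1 h1
  have h2 : ∀ᶠ ε : ℝ in 𝓝[>] 0, ε * (2 * N + 1) < min ρ (min η 1) := by
    have : Tendsto (fun ε : ℝ => ε * (2 * N + 1)) (𝓝[>] 0) (𝓝 (0 * (2 * N + 1))) :=
      (tendsto_nhdsWithin_of_tendsto_nhds tendsto_id).mul_const _
    rw [zero_mul] at this
    exact this.eventually_lt_const (by positivity)
  filter_upwards [h2, self_mem_nhdsWithin] with ε h2 h3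
  have h3 : 0 < ε := h3
  refine ⟨h3, fun r hr s hs => ?_⟩
  have hr' := norm_le_of_mem_unitCube hr
  have hs' := norm_le_of_mem_unitCube hs
  have hN : (0 : ℝ) ≤ N := Nat.cast_nonneg N
  have hε1 : ε ≤ 1 := by
    have : ε * (2 * N + 1) < 1 := h2.trans_le ((min_le_right _ _).trans (min_le_right _ _))
    nlinarith
  have e1 : ‖ε • r‖ ≤ ε * N := by
    rw [norm_smul, Real.norm_of_nonneg h3.le]; gcongr
  have e2 : ‖ε • s‖ ≤ ε * N := by
    rw [norm_smul, Real.norm_of_nonneg h3.le]; gcongr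
  have e3 : ‖ε ^ 2 • s‖ ≤ ε * N := by
    rw [norm_smul, Real.norm_of_nonneg (by positivity)]
    have : ε ^ 2 ≤ ε := by nlinarith
    gcongr
  constructor
  · refine lt_of_le_of_lt (norm_add_le _ _) (lt_of_lt_of_le ?_ (min_le_right ρ _))
    nlinarith
  · refine hρη ?_
    rw [dist_zero_right]
    refine lt_of_le_of_lt e2 (lt_of_lt_of_le ?_ (min_le_left ρ (min η 1)))
    nlinarith

/-- The mean value property for continuous compactly supported data. Translating `x` by `ε r + ε² s` changes `(x, x/ε)`
by `(0, r)` and `x/ε²` by `r/ε + s`, up to an error that vanishes with `ε`; averaging over `r` and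
`s` in the unit cube produces the mean over both tori. -/
lemma tendsto_integral_scalePoint_of_hasCompactSupport {N : ℕ} {G : RSpace N × Torus N × Torus N → ℝ}
    (hG : Continuous G) (hGs : HasCompactSupport G) :
    Tendsto (fun ε : ℝ => ∫ x, G (scalePoint ε x)) (𝓝[>] 0)
      (𝓝 (∫ x, ∫ t, ∫ t', G (x, t, t'))) := by
  obtain ⟨R, hR0, hR⟩ := exists_ball_of_hasCompactSupport hGs
  have hunif : UniformContinuous G := hGs.uniformContinuous_of_continuous hG
  obtain ⟨M, hM⟩ := hG.bounded_above_of_compact_support hGs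
  set V := (volume (Metric.ball (0 : RSpace N) (R + 1))).toReal with hV
  have hVf : volume (Metric.ball (0 : RSpace N) (R + 1)) ≠ ⊤ := measure_ball_lt_top.ne
  rw [Metric.tendsto_nhds]
  intro δ hδ
  obtain ⟨η, hη, hηG⟩ := Metric.uniformContinuous_iff.1 hunif (δ / (2 * (V + 1))) (by positivity)
  filter_upwards [eventually_small_translations (N := N) hη] with ε ⟨hε, hsm⟩
  set I := ∫ x, G (scalePoint ε x) with hI
  let K : RSpace N × RSpace N → RSpace N → ℝ := fun w x =>
    G (x, toTorus (ε⁻¹ • x) + toTorus w.1,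
      toTorus ((ε ^ 2)⁻¹ • x) + toTorus (ε⁻¹ • w.1) + toTorus w.2)
  let μ : Measure (RSpace N × RSpace N) :=
    (volume.restrict (unitCube N)).prod (volume.restrict (unitCube N))
  have hKc : Continuous (Function.uncurry K) := by
    refine hG.comp (continuous_snd.prodMk (Continuous.prodMk ?_ ?_))
    · exact (continuous_toTorus.comp (by fun_prop)).add (continuous_toTorus.comp (by fun_prop))
    · exact ((continuous_toTorus.comp (by fun_prop)).add
        (continuous_toTorus.comp (by fun_prop))).add (continuous_toTorus.comp (by fun_prop))
  have hKint : Integrable (Function.uncurry K) (μ.prod volume) := by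
    have hb : Integrable (fun q : (RSpace N × RSpace N) × RSpace N =>
        (1 : ℝ) * (Metric.ball (0 : RSpace N) R).indicator (fun _ => M) q.2) (μ.prod volume) := by
      refine (integrable_const (1 : ℝ)).mul_prod ?_
      exact (integrable_indicator_iff Metric.isOpen_ball.measurableSet).2
        (integrableOn_const measure_ball_lt_top.ne)
    refine hb.mono' hKc.aestronglyMeasurable (Eventually.of_forall fun q => ?_)
    by_cases hq : q.2 ∈ Metric.ball (0 : RSpace N) R
    · rw [indicator_of_mem hq, one_mul]; exact hM _
    · rw [indicator_of_notMem hq, mul_zero]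
      rw [mem_ball_zero_iff, not_lt] at hq
      simp [Function.uncurry, K, hR _ _ hq]
  have hGint : Integrable fun x => G (scalePoint ε x) := by
    refine (hG.comp (continuous_scalePoint ε)).integrable_of_hasCompactSupport ?_
    refine HasCompactSupport.intro (isCompact_closedBall (0 : RSpace N) R) fun x hx => ?_
    rw [mem_closedBall_zero_iff, not_le] at hx
    exact hR _ _ hx.le
  have hIK : ∀ r ∈ unitCube N, ∀ s ∈ unitCube N, |I - ∫ x, K (r, s) x| ≤ δ / 2 := by
    intro r hr s hs
    obtain ⟨hs1, hs2⟩ := hsm r hr s hs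
    have hKrs : Integrable (K (r, s)) := by
      refine (hKc.comp (by fun_prop : Continuous fun x : RSpace N =>
        ((r, s), x))).integrable_of_hasCompactSupport ?_
      refine HasCompactSupport.intro (isCompact_closedBall (0 : RSpace N) R) fun x hx => ?_
      rw [mem_closedBall_zero_iff, not_le] at hx
      exact hR _ _ hx.le
    rw [hI, ← integral_add_right_eq_self (fun x => G (scalePoint ε x)) (ε • r + ε ^ 2 • s),
      ← integral_sub (hGint.comp_add_right _) hKrs]
    have hpt : ∀ x, ‖G (scalePoint ε (x + (ε • r + ε ^ 2 • s))) - K (r, s) x‖ ≤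
        (Metric.ball (0 : RSpace N) (R + 1)).indicator (fun _ => δ / (2 * (V + 1))) x := by
      intro x
      by_cases hx : x ∈ Metric.ball (0 : RSpace N) (R + 1)
      · rw [indicator_of_mem hx, ← dist_eq_norm, scalePoint_add hε]
        refine (hηG ?_).le
        rw [Prod.dist_eq, Prod.dist_eq]
        refine max_lt ?_ (max_lt ?_ ?_)
        · rw [dist_self_add_left]; exact hs1.trans_le (min_le_left _ _)
        · rw [dist_self_add_left]; exact hs2
        · rw [dist_self]; exact hη
      · rw [indicator_of_notMem hx]
        rw [mem_ball_zero_iff, not_lt] at hx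
        have hx2 : R ≤ ‖x + (ε • r + ε ^ 2 • s)‖ := by
          have h4 := norm_le_add_norm_add x (ε • r + ε ^ 2 • s)
          have h5 := hs1.trans_le (min_le_right η 1)
          linarith
        have e1 : G (scalePoint ε (x + (ε • r + ε ^ 2 • s))) = 0 := hR _ _ hx2
        have e2 : K (r, s) x = 0 := hR _ _ (by linarith)
        rw [e1, e2]; simp
    have hind : Integrable ((Metric.ball (0 : RSpace N) (R + 1)).indicator
        (fun _ => δ / (2 * (V + 1)))) :=
      (integrable_indicator_iff Metric.isOpen_ball.measurableSet).2 (integrableOn_const hVf)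
    refine (norm_integral_le_of_norm_le hind (Eventually.of_forall hpt)).trans ?_
    rw [integral_indicator Metric.isOpen_ball.measurableSet, setIntegral_const, smul_eq_mul,
      Measure.real, ← hV]
    have : (0 : ℝ) ≤ V := ENNReal.toReal_nonneg
    rw [mul_div_assoc', div_le_div_iff₀ (by positivity) (by positivity)]
    nlinarith
  have hμ : ∀ᵐ w ∂μ, |I - ∫ x, K w x| ≤ δ / 2 := by
    have : μ = volume.restrict (unitCube N ×ˢ unitCube N) := by
      rw [Measure.volume_eq_prod, ← Measure.prod_restrict]
    rw [this]
    refine (ae_restrict_mem ((isOpen_unitCube N).prod (isOpen_unitCube N)).measurableSet).mono ?_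
    rintro ⟨r, s⟩ ⟨hr, hs⟩
    exact hIK r hr s hs
  have hswap : ∫ w, (∫ x, K w x) ∂μ = ∫ x, ∫ t, ∫ t', G (x, t, t') := by
    rw [integral_integral_swap hKint]
    refine integral_congr_ae ?_
    filter_upwards [hKint.swap.prod_right_ae] with x hx
    refine (integral_prod _ hx).trans ?_
    have h1 : ∀ r, ∫ s in unitCube N, K (r, s) x =
        ∫ t', G (x, toTorus (ε⁻¹ • x) + toTorus r, t') := fun r =>
      integral_unitCube_toTorus_add (g := fun t' => G (x, toTorus (ε⁻¹ • x) + toTorus r, t'))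
        (hG.comp (by fun_prop)).measurable (toTorus ((ε ^ 2)⁻¹ • x) + toTorus (ε⁻¹ • r))
    have h2 := integral_unitCube_toTorus_add (g := fun t => ∫ t', G (x, t, t')) ?_
      (toTorus (ε⁻¹ • x))
    · rw [← h2]
      exact integral_congr_ae (Eventually.of_forall h1)
    · have : StronglyMeasurable (Function.uncurry fun t t' : Torus N => G (x, t, t')) :=
        (hG.comp (by fun_prop)).stronglyMeasurable
      exact this.integral_prod_right.measurable
  have hfin : |I - ∫ x, ∫ t, ∫ t', G (x, t, t')| ≤ δ / 2 := by
    rw [← hswap]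
    have h1 : I = ∫ _w, I ∂μ := by simp
    have h2 : I - ∫ w, (∫ x, K w x) ∂μ = ∫ w, (I - ∫ x, K w x) ∂μ := by
      exact ((integral_sub (integrable_const _) hKint.integral_prod_left).trans
        (by rw [← h1]; rfl)).symm
    rw [h2, ← Real.norm_eq_abs]
    refine (norm_integral_le_of_norm_le_const (C := δ / 2) hμ).trans ?_
    simp
  rw [Real.dist_eq]
  linarith

instance (N : ℕ) : BorelSpace (RSpace N × Torus N × Torus N) :=
  Prod.borelSpace

lemma tendsto_of_forall_approx {ι : Type*} {l : Filter ι} {u : ι → ℝ} {c : ℝ}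
    (h : ∀ δ > 0, ∃ (u' : ι → ℝ) (c' : ℝ), Tendsto u' l (𝓝 c') ∧
      (∀ᶠ i in l, |u i - u' i| ≤ δ) ∧ |c - c'| ≤ δ) : Tendsto u l (𝓝 c) := by
  rw [Metric.tendsto_nhds]
  intro δ hδ
  obtain ⟨u', c', h1, h2, h3⟩ := h (δ / 4) (by positivity)
  filter_upwards [h2, Metric.tendsto_nhds.1 h1 (δ / 4) (by positivity)] with i h4 h5
  rw [Real.dist_eq] at h5 ⊢
  rw [abs_le] at h3 h4
  rw [abs_lt] at h5 ⊢
  constructor <;> linarith [h3.1, h3.2, h4.1, h4.2, h5.1, h5.2]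

lemma abs_integral_sub_le_of_lintegral {α : Type*} [MeasurableSpace α] {μ : Measure α} {f g : α → ℝ}
    (hf : Integrable f μ) (hg : Integrable g μ) {δ : ℝ} (hδ : 0 ≤ δ)
    (h : ∫⁻ x, ‖f x - g x‖ₑ ∂μ ≤ ENNReal.ofReal δ) : |∫ x, f x ∂μ - ∫ x, g x ∂μ| ≤ δ := by
  rw [← integral_sub hf hg]
  have h1 := (enorm_integral_le_lintegral_enorm (μ := μ) fun x => f x - g x).trans h
  rwa [Real.enorm_eq_ofReal_abs, ENNReal.ofReal_le_ofReal_iff hδ] at h1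

lemma exists_pos_mul_le_ofReal {W : ENNReal} (hW : W ≠ ⊤) {δ : ℝ} (hδ : 0 < δ) :
    ∃ δ' : ENNReal, δ' ≠ 0 ∧ W * δ' ≤ ENNReal.ofReal δ := by
  refine ⟨ENNReal.ofReal δ / (W + 1), ?_, ?_⟩
  · exact (ENNReal.div_pos (by simpa using hδ) (by simp [hW])).ne'
  · rw [← mul_div_assoc]
    refine ENNReal.div_le_of_le_mul ?_
    rw [mul_comm]
    gcongr
    exact le_self_add

/-- The mean value property with a factor in the intermediate variable that is merely bounded and
measurable: approximate that factor in `L¹` of the torus by continuous functions. -/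
lemma tendsto_integral_mul_scalePoint_of_hasCompactSupport {N : ℕ} {a : Torus N → ℝ}
    (ha : Measurable a) {A : ℝ} (haA : ∀ t, |a t| ≤ A) {G : RSpace N × Torus N × Torus N → ℝ}
    (hG : Continuous G) (hGs : HasCompactSupport G) :
    Tendsto (fun ε : ℝ => ∫ x, a (toTorus (ε⁻¹ • x)) * G (scalePoint ε x)) (𝓝[>] 0)
      (𝓝 (∫ p, a p.2.1 * G p)) := by
  obtain ⟨R, hR0, hR⟩ := exists_ball_of_hasCompactSupport hGs
  obtain ⟨M, hM⟩ := hG.bounded_above_of_compact_support hGs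
  have hM0 : 0 ≤ M := (norm_nonneg _).trans (hM (0, 0, 0))
  set W := ENNReal.ofReal M * volume (Metric.ball (0 : RSpace N) (R + N)) with hW
  have hWf : W ≠ ⊤ := ENNReal.mul_ne_top ENNReal.ofReal_ne_top measure_ball_lt_top.ne
  have hai : Integrable a :=
    (integrable_const A).mono' ha.aestronglyMeasurable (Eventually.of_forall haA)
  have hGε : ∀ ε : ℝ, Integrable fun x => G (scalePoint ε x) := fun ε => by
    refine (hG.comp (continuous_scalePoint ε)).integrable_of_hasCompactSupport ?_
    refine HasCompactSupport.intro (isCompact_closedBall (0 : RSpace N) R) fun x hx => ?_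
    rw [mem_closedBall_zero_iff, not_le] at hx
    exact hR _ _ hx.le
  have hGi : Integrable G := hG.integrable_of_hasCompactSupport hGs
  refine tendsto_of_forall_approx fun δ hδ => ?_
  obtain ⟨δ', hδ'0, hδ'⟩ := exists_pos_mul_le_ofReal hWf hδ
  obtain ⟨g, hg, -⟩ := hai.exists_boundedContinuous_lintegral_sub_le hδ'0
  have hG' : Continuous fun p : RSpace N × Torus N × Torus N => g p.2.1 * G p :=
    (g.continuous.comp (by fun_prop)).mul hG
  have hG's : HasCompactSupport fun p : RSpace N × Torus N × Torus N => g p.2.1 * G p :=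
    hGs.mul_left
  have hGi' : Integrable fun p : RSpace N × Torus N × Torus N => g p.2.1 * G p :=
    hG'.integrable_of_hasCompactSupport hG's
  have hmeas : Measurable fun t => ‖a t - g t‖ₑ := (ha.sub g.continuous.measurable).enorm
  refine ⟨_, _, tendsto_integral_scalePoint_of_hasCompactSupport hG' hG's, ?_, ?_⟩
  · have h1 : ∀ᶠ ε : ℝ in 𝓝[>] 0, ε ≤ 1 :=
      (eventually_le_nhds zero_lt_one).filter_mono nhdsWithin_le_nhds
    filter_upwards [h1, self_mem_nhdsWithin] with ε h1 h0
    have hc : Continuous fun x : RSpace N => toTorus (ε⁻¹ • x) :=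
      continuous_toTorus.comp (by fun_prop)
    have hmc : Measurable fun x : RSpace N =>
        ‖a (toTorus (ε⁻¹ • x)) - g (toTorus (ε⁻¹ • x))‖ₑ := hmeas.comp hc.measurable
    refine abs_integral_sub_le_of_lintegral ?_ ?_ hδ.le ?_
    · exact (hGε ε).bdd_mul (ha.comp hc.measurable).aestronglyMeasurable
        (Eventually.of_forall fun x => haA _)
    · exact (hGε ε).bdd_mul (g.continuous.comp hc).aestronglyMeasurable
        (Eventually.of_forall fun x => g.norm_coe_le_norm _)
    · calc ∫⁻ x, ‖a (toTorus (ε⁻¹ • x)) * G (scalePoint ε x)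
            - g (toTorus (ε⁻¹ • x)) * G (scalePoint ε x)‖ₑ
          ≤ ∫⁻ x, (Metric.ball (0 : RSpace N) R).indicator (fun x => ENNReal.ofReal M *
            ‖a (toTorus (ε⁻¹ • x)) - g (toTorus (ε⁻¹ • x))‖ₑ) x := by
            refine lintegral_mono fun x => ?_
            by_cases hx : x ∈ Metric.ball (0 : RSpace N) R
            · rw [indicator_of_mem hx, ← sub_mul, enorm_mul, mul_comm]
              gcongr
              rw [Real.enorm_eq_ofReal_abs]
              exact ENNReal.ofReal_le_ofReal (hM _)
            · have : G (scalePoint ε x) = 0 := by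
                rw [mem_ball_zero_iff, not_lt] at hx
                exact hR _ _ hx
              simp [this]
        _ ≤ W * δ' := by
            rw [lintegral_indicator Metric.isOpen_ball.measurableSet,
              lintegral_const_mul _ hmc, hW, mul_assoc]
            gcongr
            exact (lintegral_ball_comp_toTorus_le hmeas h0 h1 R).trans (by gcongr)
        _ ≤ ENNReal.ofReal δ := hδ'
  · have hint : ∫ x, ∫ t, ∫ t', g t * G (x, t, t') =
        ∫ p : RSpace N × Torus N × Torus N, g p.2.1 * G p := by
      have h2 := integral_prod _ hGi'
      refine Eq.trans ?_ h2.symm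
      refine integral_congr_ae ?_
      filter_upwards [hGi'.prod_right_ae] with x hx
      exact (integral_prod _ hx).symm
    simp only
    rw [hint]
    refine abs_integral_sub_le_of_lintegral ?_ hGi' hδ.le ?_
    · exact hGi.bdd_mul (ha.comp (by fun_prop)).aestronglyMeasurable
        (Eventually.of_forall fun x => haA _)
    · calc ∫⁻ p : RSpace N × Torus N × Torus N, ‖a p.2.1 * G p - g p.2.1 * G p‖ₑ
          ≤ ∫⁻ p : RSpace N × Torus N × Torus N,
            (Metric.ball (0 : RSpace N) (R + N)).indicator (fun _ => ENNReal.ofReal M) p.1 *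
              ‖a p.2.1 - g p.2.1‖ₑ := by
            refine lintegral_mono fun p => ?_
            by_cases hx : p.1 ∈ Metric.ball (0 : RSpace N) (R + N)
            · rw [indicator_of_mem hx, ← sub_mul, enorm_mul, mul_comm]
              gcongr
              rw [Real.enorm_eq_ofReal_abs]
              exact ENNReal.ofReal_le_ofReal (hM _)
            · have : G p = 0 := by
                rw [mem_ball_zero_iff, not_lt] at hx
                exact hR p.1 p.2 (by linarith [(Nat.cast_nonneg N : (0 : ℝ) ≤ N)])
              simp [this]
        _ = W * ∫⁻ t, ‖a t - g t‖ₑ := by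
            have e1 := lintegral_prod_mul (μ := (volume : Measure (RSpace N)))
              (ν := (volume : Measure (Torus N × Torus N)))
              (f := (Metric.ball (0 : RSpace N) (R + N)).indicator (fun _ => ENNReal.ofReal M))
              (g := fun t => ‖a t.1 - g t.1‖ₑ)
              (measurable_const.indicator Metric.isOpen_ball.measurableSet).aemeasurable
              (hmeas.comp measurable_fst).aemeasurable
            have e2 := lintegral_prod_mul (μ := (volume : Measure (Torus N)))
              (ν := (volume : Measure (Torus N)))
              (f := fun t => ‖a t - g t‖ₑ) (g := fun _ => 1) hmeas.aemeasurable
              aemeasurable_const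
            simp only [mul_one, lintegral_one, measure_univ] at e2
            refine e1.trans ?_
            rw [lintegral_indicator_const Metric.isOpen_ball.measurableSet, hW]
            congr 1
        _ ≤ W * δ' := by gcongr
        _ ≤ ENNReal.ofReal δ := hδ'

/-- The map `(x, y, z) ↦ (x, [y], [z])` from `(ℝ^N)³` to `ℝ^N × (ℝ^N/ℤ^N)²`. -/
def torusPoint {N : ℕ} (p : RSpace N × RSpace N × RSpace N) : RSpace N × Torus N × Torus N :=
  (p.1, toTorus p.2.1, toTorus p.2.2)

lemma continuous_torusPoint {N : ℕ} :
    Continuous (torusPoint : RSpace N × RSpace N × RSpace N → RSpace N × Torus N × Torus N) :=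
  continuous_fst.prodMk ((continuous_toTorus.comp (by fun_prop)).prodMk
    (continuous_toTorus.comp (by fun_prop)))

lemma volume_restrict_prod_cubes {N : ℕ} (Ω : Set (RSpace N)) :
    (volume : Measure (RSpace N × RSpace N × RSpace N)).restrict
      (Ω ×ˢ (unitCube N ×ˢ unitCube N)) = (volume.restrict Ω).prod
        ((volume.restrict (unitCube N)).prod (volume.restrict (unitCube N))) := by
  rw [Measure.prod_restrict, Measure.prod_restrict]; rfl

lemma measurePreserving_torusPoint {N : ℕ} (Ω : Set (RSpace N)) :
    MeasurePreserving (torusPoint (N := N))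
      (volume.restrict (Ω ×ˢ (unitCube N ×ˢ unitCube N)))
      ((volume.restrict Ω).prod volume) := by
  rw [volume_restrict_prod_cubes]
  exact (MeasurePreserving.id (volume.restrict Ω)).prod
    ((measurePreserving_toTorus N).prod (measurePreserving_toTorus N))

/-- The mean value property over a set `Ω` of finite measure: approximate the indicator of `Ω` in
`L¹` by continuous compactly supported functions. -/
lemma tendsto_setIntegral_mul_scalePoint {N : ℕ} {Ω : Set (RSpace N)} (hΩ : MeasurableSet Ω)
    (hΩf : volume Ω ≠ ⊤) {a : Torus N → ℝ} (ha : Measurable a) {A : ℝ} (haA : ∀ t, |a t| ≤ A)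
    (H : BoundedContinuousFunction (RSpace N × Torus N × Torus N) ℝ) :
    Tendsto (fun ε : ℝ => ∫ x in Ω, a (toTorus (ε⁻¹ • x)) * H (scalePoint ε x)) (𝓝[>] 0)
      (𝓝 (∫ p in Ω ×ˢ (unitCube N ×ˢ unitCube N),
        a (toTorus p.2.1) * H (torusPoint p))) := by
  have hA0 : 0 ≤ A := (abs_nonneg _).trans (haA 0)
  have hlim : ∫ p in Ω ×ˢ (unitCube N ×ˢ unitCube N), a (toTorus p.2.1) * H (torusPoint p) =
      ∫ p, Ω.indicator (fun _ => (1 : ℝ)) p.1 * (a p.2.1 * H p) := by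
    have h1 := (measurePreserving_torusPoint Ω).map_eq
    have h2 : AEStronglyMeasurable (fun p : RSpace N × Torus N × Torus N => a p.2.1 * H p)
        (Measure.map torusPoint (volume.restrict (Ω ×ˢ (unitCube N ×ˢ unitCube N)))) :=
      ((ha.comp (by fun_prop)).mul H.continuous.measurable).aestronglyMeasurable
    have h3 := integral_map continuous_torusPoint.aemeasurable h2
    rw [h1] at h3
    refine h3.symm.trans ?_
    have h4 : (volume.restrict Ω).prod (volume : Measure (Torus N × Torus N)) =
        (volume : Measure (RSpace N × Torus N × Torus N)).restrict (Ω ×ˢ univ) := by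
      rw [Measure.volume_eq_prod (RSpace N), ← Measure.prod_restrict, Measure.restrict_univ]
    rw [h4, ← integral_indicator (hΩ.prod MeasurableSet.univ)]
    congr 1
    ext p
    by_cases hp : p.1 ∈ Ω <;> simp [indicator, hp]
  rw [hlim]
  have hset : ∀ ε : ℝ, ∫ x in Ω, a (toTorus (ε⁻¹ • x)) * H (scalePoint ε x) =
      ∫ x, Ω.indicator (fun _ => (1 : ℝ)) x *
        (a (toTorus (ε⁻¹ • x)) * H (scalePoint ε x)) := fun ε => by
    rw [← integral_indicator hΩ]
    congr 1
    ext x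
    by_cases hx : x ∈ Ω <;> simp [indicator, hx]
  simp only [hset]
  have hind : Integrable (Ω.indicator fun _ => (1 : ℝ)) :=
    (integrable_indicator_iff hΩ).2 (integrableOn_const hΩf)
  refine tendsto_of_forall_approx fun δ hδ => ?_
  obtain ⟨δ', hδ'0, hδ'⟩ :=
    exists_pos_mul_le_ofReal (W := ENNReal.ofReal (A * ‖H‖)) ENNReal.ofReal_ne_top hδ
  obtain ⟨κ, hκs, hκ, hκc, hκi⟩ := hind.exists_hasCompactSupport_lintegral_sub_le hδ'0
  have hG : Continuous fun p : RSpace N × Torus N × Torus N => κ p.1 * H p :=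
    (hκc.comp continuous_fst).mul H.continuous
  have hGs : HasCompactSupport fun p : RSpace N × Torus N × Torus N => κ p.1 * H p := by
    refine HasCompactSupport.intro (hκs.isCompact.prod isCompact_univ) fun p hp => ?_
    have : p.1 ∉ tsupport κ := fun h => hp ⟨h, mem_univ _⟩
    rw [image_eq_zero_of_notMem_tsupport this, zero_mul]
  have hbound : ∀ (t : Torus N) (q : RSpace N × Torus N × Torus N), ‖a t * H q‖ ≤ A * ‖H‖ :=
    fun t q => by
      rw [norm_mul]
      exact mul_le_mul (haA t) (H.norm_coe_le_norm q) (norm_nonneg _) hA0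
  have hpt : ∀ (x y : ℝ) (t : Torus N) (q : RSpace N × Torus N × Torus N),
      ‖x * (a t * H q) - y * (a t * H q)‖ₑ ≤ ENNReal.ofReal (A * ‖H‖) * ‖x - y‖ₑ := by
    intro x y t q
    rw [← sub_mul, enorm_mul, mul_comm]
    gcongr
    rw [Real.enorm_eq_ofReal_abs]
    exact ENNReal.ofReal_le_ofReal (hbound t q)
  have hm : Measurable fun x => ‖Ω.indicator (fun _ => (1 : ℝ)) x - κ x‖ₑ :=
    ((measurable_const.indicator hΩ).sub hκc.measurable).enorm
  refine ⟨_, _, tendsto_integral_mul_scalePoint_of_hasCompactSupport ha haA hG hGs, ?_, ?_⟩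
  · refine Eventually.of_forall fun ε => ?_
    have hc : Continuous fun x : RSpace N => toTorus (ε⁻¹ • x) :=
      continuous_toTorus.comp (by fun_prop)
    have hm1 : AEStronglyMeasurable
        (fun x : RSpace N => a (toTorus (ε⁻¹ • x)) * H (scalePoint ε x)) volume :=
      ((ha.comp hc.measurable).mul
        (H.continuous.comp (continuous_scalePoint ε)).measurable).aestronglyMeasurable
    have e : ∀ x, a (toTorus (ε⁻¹ • x)) * (κ (scalePoint ε x).1 * H (scalePoint ε x)) =
        κ x * (a (toTorus (ε⁻¹ • x)) * H (scalePoint ε x)) := fun x => by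
      simp only [scalePoint]; ring
    simp only [e]
    refine abs_integral_sub_le_of_lintegral
      (hind.mul_bdd hm1 (Eventually.of_forall fun x => hbound _ _))
      (hκi.mul_bdd hm1 (Eventually.of_forall fun x => hbound _ _)) hδ.le ?_
    refine (lintegral_mono fun x => hpt _ _ _ _).trans ?_
    rw [lintegral_const_mul _ hm]
    exact le_trans (by gcongr) hδ'
  · have hm1 : AEStronglyMeasurable
        (fun p : RSpace N × Torus N × Torus N => a p.2.1 * H p) volume :=
      ((ha.comp (by fun_prop)).mul H.continuous.measurable).aestronglyMeasurable
    have e : ∀ p : RSpace N × Torus N × Torus N, a p.2.1 * (κ p.1 * H p) =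
        κ p.1 * (a p.2.1 * H p) := fun p => by ring
    simp only [e]
    refine abs_integral_sub_le_of_lintegral
      (Integrable.mul_bdd (hind.comp_fst volume) hm1 (Eventually.of_forall fun x => hbound _ _))
      (Integrable.mul_bdd (hκi.comp_fst volume) hm1 (Eventually.of_forall fun x => hbound _ _)) hδ.le ?_
    refine (lintegral_mono fun p => hpt _ _ _ _).trans ?_
    have hm2 : Measurable fun p : RSpace N × Torus N × Torus N =>
        ‖Ω.indicator (fun _ => (1 : ℝ)) p.1 - κ p.1‖ₑ := hm.comp measurable_fst
    rw [lintegral_const_mul _ hm2]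
    refine le_trans ?_ hδ'
    gcongr
    refine le_trans (le_of_eq ?_) hκ
    have e1 := lintegral_prod_mul (μ := (volume : Measure (RSpace N)))
      (ν := (volume : Measure (Torus N × Torus N)))
      (f := fun x => ‖Ω.indicator (fun _ => (1 : ℝ)) x - κ x‖ₑ) (g := fun _ => 1)
      hm.aemeasurable aemeasurable_const
    simp only [mul_one, lintegral_one, measure_univ] at e1
    exact e1

/-! ### N-functions and the `Δ₂` condition -/

lemma IsNFunction.map_zero {B : ℝ → ℝ} (hB : IsNFunction B) : B 0 = 0 := by
  have h1 : Tendsto B (𝓝[>] 0) (𝓝 (B 0)) :=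
    (hB.continuousOn 0 self_mem_Ici).tendsto.mono_left (nhdsWithin_mono _ Ioi_subset_Ici_self)
  have h2 : Tendsto (fun t => B t / t * t) (𝓝[>] 0) (𝓝 (0 * 0)) :=
    hB.tendsto_zero.mul (tendsto_nhdsWithin_of_tendsto_nhds tendsto_id)
  rw [zero_mul] at h2
  refine tendsto_nhds_unique h1 (h2.congr' ?_)
  filter_upwards [self_mem_nhdsWithin] with t ht
  exact div_mul_cancel₀ _ (ne_of_gt ht)

lemma IsNFunction.nonneg {B : ℝ → ℝ} (hB : IsNFunction B) {t : ℝ} (ht : 0 ≤ t) : 0 ≤ B t := by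
  rcases ht.eq_or_lt with rfl | ht
  · exact hB.map_zero.ge
  · exact (hB.pos t ht).le

lemma IsNFunction.monotoneOn {B : ℝ → ℝ} (hB : IsNFunction B) : MonotoneOn B (Ici 0) := by
  intro s hs t ht hst
  rcases eq_or_lt_of_le (mem_Ici.1 ht) with h0 | h0
  · have : s = t := le_antisymm hst (h0 ▸ hs)
    rw [this]
  have hs' : 0 ≤ s := hs
  have h := hB.convexOn.2 (self_mem_Ici (a := (0 : ℝ))) ht
    (show 0 ≤ 1 - s / t by rw [sub_nonneg, div_le_one h0]; exact hst)
    (show 0 ≤ s / t by positivity) (by ring)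
  simp only [smul_eq_mul, mul_zero, zero_add, hB.map_zero, div_mul_cancel₀ _ h0.ne'] at h
  refine h.trans (mul_le_of_le_one_left (hB.nonneg ht) ?_)
  rw [div_le_one h0]; exact hst

lemma IsNFunction.exists_mul_le_add {B : ℝ → ℝ} (hB : IsNFunction B) (M : ℝ) {c : ℝ} (hc : 0 < c) :
    ∃ C : ℝ, 0 ≤ C ∧ ∀ s, 0 ≤ s → M * s ≤ c * B s + C := by
  obtain ⟨S, hS⟩ := eventually_atTop.1 (hB.tendsto_top.eventually_ge_atTop (M / c))
  refine ⟨|M| * max S 1, by positivity, fun s hs => ?_⟩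
  by_cases h : max S 1 ≤ s
  · have h1 := hS s ((le_max_left _ _).trans h)
    have hs0 : 0 < s := lt_of_lt_of_le one_pos ((le_max_right _ _).trans h)
    rw [div_le_div_iff₀ hc hs0] at h1
    have : 0 ≤ |M| * max S 1 := by positivity
    linarith
  · push Not at h
    have h1 : M * s ≤ |M| * max S 1 :=
      mul_le_mul (le_abs_self M) h.le hs (abs_nonneg M)
    have := mul_nonneg hc.le (hB.nonneg hs)
    linarith

/-- Iterating `Δ₂` and absorbing the bounded range of `t` into a constant. -/
lemma IsNFunction.exists_dilation_le {B : ℝ → ℝ} (hB : IsNFunction B) (hB2 : DeltaTwo B) {M : ℝ}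
    (hM : 0 ≤ M) : ∃ C : ℝ, 0 ≤ C ∧ ∀ t, 0 ≤ t → B (M * t) ≤ C * (1 + B t) := by
  have key : ∀ k : ℕ, ∃ C : ℝ, 0 ≤ C ∧ ∀ t, 0 ≤ t → B (2 ^ k * t) ≤ C * (1 + B t) := by
    obtain ⟨α, hα, t₀, ht₀, h⟩ := hB2
    have hα' : ∀ t, 0 ≤ t → B (2 * t) ≤ (α + B (2 * t₀)) * (1 + B t) := by
      intro t ht
      have h0 := hB.nonneg ht
      have h1 : 0 ≤ B (2 * t₀) := hB.nonneg (by positivity)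
      by_cases hlt : t₀ ≤ t
      · have := h t hlt
        nlinarith [mul_nonneg h1 h0]
      · push Not at hlt
        have := hB.monotoneOn (mem_Ici.2 (by positivity : 0 ≤ 2 * t))
          (mem_Ici.2 (by positivity : 0 ≤ 2 * t₀)) (by linarith)
        nlinarith [mul_nonneg h1 h0, mul_nonneg hα.le h0]
    have hβ : 0 ≤ α + B (2 * t₀) := add_nonneg hα.le (hB.nonneg (by positivity))
    intro k
    induction k with
    | zero => exact ⟨1, zero_le_one, fun t ht => by simp⟩
    | succ k ih =>
      obtain ⟨C, hC, hk⟩ := ih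
      refine ⟨(α + B (2 * t₀)) * (1 + C), by positivity, fun t ht => ?_⟩
      have h1 := hα' (2 ^ k * t) (by positivity)
      have h2 := hk t ht
      have h3 := hB.nonneg ht
      calc B (2 ^ (k + 1) * t) = B (2 * (2 ^ k * t)) := by ring_nf
        _ ≤ (α + B (2 * t₀)) * (1 + B (2 ^ k * t)) := h1
        _ ≤ (α + B (2 * t₀)) * ((1 + C) * (1 + B t)) := by gcongr; linarith
        _ = _ := by ring
  obtain ⟨k, hk⟩ := pow_unbounded_of_one_lt M (one_lt_two : (1 : ℝ) < 2)
  obtain ⟨C, hC, hCk⟩ := key k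
  refine ⟨C, hC, fun t ht => ?_⟩
  refine le_trans (hB.monotoneOn (mem_Ici.2 (by positivity)) (mem_Ici.2 (by positivity)) ?_)
    (hCk t ht)
  gcongr

lemma bddAbove_complementaryFun {B : ℝ → ℝ} (hB : IsNFunction B) (t : ℝ) :
    BddAbove ((fun s : ℝ => s * t - B s) '' Ici 0) := by
  obtain ⟨C, -, hC⟩ := hB.exists_mul_le_add t one_pos
  refine ⟨C, ?_⟩
  rintro _ ⟨s, hs, rfl⟩
  have := hC s hs
  simp only
  linarith

lemma complementaryFun_nonneg {B : ℝ → ℝ} (hB : IsNFunction B) (t : ℝ) :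
    0 ≤ complementaryFun B t :=
  le_csSup (bddAbove_complementaryFun hB t) ⟨0, self_mem_Ici, by simp [hB.map_zero]⟩

lemma complementaryFun_le_mul {B : ℝ → ℝ} (hB : IsNFunction B) {t : ℝ} (h0 : 0 ≤ t) (h1 : t ≤ 1) :
    complementaryFun B t ≤ t * complementaryFun B 1 := by
  refine csSup_le (nonempty_Ici.image _) ?_
  rintro _ ⟨s, hs, rfl⟩
  have hs : 0 ≤ s := hs
  have h2 : s * 1 - B s ≤ complementaryFun B 1 := le_csSup (bddAbove_complementaryFun hB 1) ⟨s, hs, rfl⟩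
  have h3 := mul_le_mul_of_nonneg_left h2 h0
  have h4 := mul_le_of_le_one_left (hB.nonneg hs) h1
  simp only
  nlinarith

/-! ### Test functions -/

/-- The test function `x ↦ H (x, [·], [·])` induced by a bounded continuous function `H` on
`ℝ^N × (ℝ^N/ℤ^N)²`. -/
noncomputable def torusTest {N : ℕ}
    (H : BoundedContinuousFunction (RSpace N × Torus N × Torus N) ℝ) (x : RSpace N) :
    BoundedContinuousFunction (RSpace N × RSpace N) ℝ :=
  (BoundedContinuousFunction.mkOfCompact (H.toContinuousMap.curry x)).compContinuous
    ⟨Prod.map toTorus toTorus, continuous_toTorus.prodMap continuous_toTorus⟩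

lemma torusTest_apply {N : ℕ} (H : BoundedContinuousFunction (RSpace N × Torus N × Torus N) ℝ)
    (x : RSpace N) (q : RSpace N × RSpace N) :
    torusTest H x q = H (x, toTorus q.1, toTorus q.2) := rfl

lemma continuous_torusTest {N : ℕ}
    (H : BoundedContinuousFunction (RSpace N × Torus N × Torus N) ℝ) : Continuous (torusTest H) :=
  (BoundedContinuousFunction.continuous_compContinuous _).comp
    ((ContinuousMap.isometryEquivBoundedOfCompact (Torus N × Torus N) ℝ).continuous.comp
      (ContinuousMap.continuous _))

lemma norm_torusTest_le {N : ℕ}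
    (H : BoundedContinuousFunction (RSpace N × Torus N × Torus N) ℝ) (x : RSpace N) :
    ‖torusTest H x‖ ≤ ‖H‖ :=
  (BoundedContinuousFunction.norm_le (norm_nonneg _)).2 fun _ => H.norm_coe_le_norm _

lemma memOrliczCPer_torusTest {N : ℕ} {B : ℝ → ℝ} (hB : IsNFunction B) {Ω : Set (RSpace N)}
    (hΩf : volume Ω ≠ ⊤) (H : BoundedContinuousFunction (RSpace N × Torus N × Torus N) ℝ) :
    MemOrliczCPer (complementaryFun B) Ω (torusTest H) := by
  refine ⟨(continuous_torusTest H).aestronglyMeasurable, Eventually.of_forall fun x k h y z => ?_,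
    (continuous_torusTest H).norm.aestronglyMeasurable, ?_⟩
  · simp only [torusTest_apply, toTorus_add_intVec]
  · set c := complementaryFun B 1 with hc
    have hc0 : 0 ≤ c := complementaryFun_nonneg hB 1
    have hlim : Tendsto (fun δ : ℝ => ENNReal.ofReal (δ * (‖H‖ * c)) * volume Ω) (𝓝[>] 0) (𝓝 0) := by
      have h1 : Tendsto (fun δ : ℝ => δ * (‖H‖ * c)) (𝓝[>] 0) (𝓝 (0 * (‖H‖ * c))) :=
        (tendsto_nhdsWithin_of_tendsto_nhds tendsto_id).mul_const _
      have h2 := ENNReal.Tendsto.mul_const (b := volume Ω) (ENNReal.tendsto_ofReal h1)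
        (Or.inr hΩf)
      simpa using h2
    refine tendsto_of_tendsto_of_tendsto_of_le_of_le' tendsto_const_nhds hlim
      (Eventually.of_forall fun _ => zero_le) ?_
    have hsmall : ∀ᶠ δ : ℝ in 𝓝[>] 0, δ * ‖H‖ ≤ 1 := by
      have h1 : Tendsto (fun δ : ℝ => δ * ‖H‖) (𝓝[>] 0) (𝓝 (0 * ‖H‖)) :=
        (tendsto_nhdsWithin_of_tendsto_nhds tendsto_id).mul_const _
      rw [zero_mul] at h1
      exact h1.eventually_le_const one_pos
    filter_upwards [hsmall, self_mem_nhdsWithin] with δ hδ hδ0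
    have hδ0 : 0 < δ := hδ0
    rw [← setLIntegral_const]
    refine lintegral_mono fun x => ENNReal.ofReal_le_ofReal ?_
    rw [abs_of_nonneg (norm_nonneg _)]
    have h1 : δ * ‖torusTest H x‖ ≤ δ * ‖H‖ := by gcongr; exact norm_torusTest_le H x
    refine (complementaryFun_le_mul hB (by positivity) (h1.trans hδ)).trans ?_
    rw [← mul_assoc]
    exact mul_le_mul_of_nonneg_right h1 hc0

/-! ### Selecting the larger of finitely many integrands by continuous cut-offs -/

lemma exists_measurableSet_preimage_torusPoint {N : ℕ} {Ω : Set (RSpace N)} (hΩ : MeasurableSet Ω)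
    {A : Set (RSpace N × RSpace N × RSpace N)} (hA : MeasurableSet A) :
    ∃ A' : Set (RSpace N × Torus N × Torus N), MeasurableSet A' ∧
      ∀ p ∈ Ω ×ˢ (unitCube N ×ˢ unitCube N), torusPoint p ∈ A' ↔ p ∈ A := by
  have hD : MeasurableSet (Ω ×ˢ (unitCube N ×ˢ unitCube N)) :=
    hΩ.prod ((isOpen_unitCube N).prod (isOpen_unitCube N)).measurableSet
  have hinj : InjOn (torusPoint (N := N)) (Ω ×ˢ (unitCube N ×ˢ unitCube N)) := by
    rintro ⟨x, y, z⟩ ⟨-, hy, hz⟩ ⟨x', y', z'⟩ ⟨-, hy', hz'⟩ h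
    simp only [torusPoint, Prod.mk.injEq] at h
    obtain ⟨rfl, h1, h2⟩ := h
    exact Prod.ext rfl (Prod.ext (injOn_toTorus hy hy' h1) (injOn_toTorus hz hz' h2))
  refine ⟨torusPoint '' (A ∩ Ω ×ˢ (unitCube N ×ˢ unitCube N)), ?_, fun p hp => ⟨?_, fun h => ?_⟩⟩
  · exact (hA.inter hD).image_of_continuousOn_injOn continuous_torusPoint.continuousOn
      (hinj.mono inter_subset_right)
  · rintro ⟨q, ⟨hqA, hqD⟩, hq⟩
    rwa [← hinj hqD hp hq]
  · exact ⟨p, ⟨h, hp⟩, rfl⟩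

/-- The positive part of an integrable function is nearly captured by a continuous cut-off that is
periodic in `y` and `z`: the approximation takes place in `L¹` of the image under `torusPoint` of
the measure with density `|h|`. -/
lemma exists_cutoff_integral_ge {N : ℕ} {Ω : Set (RSpace N)} (hΩ : MeasurableSet Ω)
    {h : RSpace N × RSpace N × RSpace N → ℝ}
    (hh : IntegrableOn h (Ω ×ˢ (unitCube N ×ˢ unitCube N))) {δ : ℝ} (hδ : 0 < δ) :
    ∃ H : BoundedContinuousFunction (RSpace N × Torus N × Torus N) ℝ,
      (∀ q, 0 ≤ H q) ∧ (∀ q, H q ≤ 1) ∧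
      ∫ p in Ω ×ˢ (unitCube N ×ˢ unitCube N), max (h p) 0 ≤
        (∫ p in Ω ×ˢ (unitCube N ×ˢ unitCube N), H (torusPoint p) * h p) + δ := by
  set D : Set (RSpace N × RSpace N × RSpace N) := Ω ×ˢ (unitCube N ×ˢ unitCube N) with hDdef
  have hD : MeasurableSet D :=
    hΩ.prod ((isOpen_unitCube N).prod (isOpen_unitCube N)).measurableSet
  set h' := hh.aestronglyMeasurable.mk h with hh'
  have hh'm : StronglyMeasurable h' := hh.aestronglyMeasurable.stronglyMeasurable_mk
  have hae : h =ᵐ[volume.restrict D] h' := hh.aestronglyMeasurable.ae_eq_mk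
  have hi' : Integrable h' (volume.restrict D) := hh.congr hae
  have hA : MeasurableSet {p | 0 < h' p} := measurableSet_lt measurable_const hh'm.measurable
  obtain ⟨A', hA'm, hA'⟩ := exists_measurableSet_preimage_torusPoint hΩ hA
  set ν : Measure (RSpace N × Torus N × Torus N) :=
    ((volume.restrict D).withDensity fun p => ‖h' p‖ₑ).map torusPoint with hν
  have hfin : IsFiniteMeasure ((volume.restrict D).withDensity fun p => ‖h' p‖ₑ) :=
    isFiniteMeasure_withDensity hi'.2.ne
  have : IsFiniteMeasure ν := by rw [hν]; infer_instance
  have hind : Integrable (A'.indicator fun _ => (1 : ℝ)) ν :=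
    (integrable_const 1).indicator hA'm
  obtain ⟨g, hg, -⟩ := hind.exists_boundedContinuous_lintegral_sub_le
    (ε := ENNReal.ofReal δ) (by simpa using hδ)
  have hHapp : ∀ q, ((g ⊓ 1) ⊔ 0 : BoundedContinuousFunction _ ℝ) q = max (min (g q) 1) 0 :=
    fun q => rfl
  refine ⟨(g ⊓ 1) ⊔ 0, fun q => ?_, fun q => ?_, ?_⟩
  · rw [hHapp]; exact le_max_right _ _
  · rw [hHapp]; exact max_le (min_le_right _ _) zero_le_one
  set H : BoundedContinuousFunction (RSpace N × Torus N × Torus N) ℝ := (g ⊓ 1) ⊔ 0 with hH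
  have hHg : ∀ q, ‖A'.indicator (fun _ => (1 : ℝ)) q - H q‖ₑ ≤
      ‖A'.indicator (fun _ => (1 : ℝ)) q - g q‖ₑ := by
    intro q
    rw [Real.enorm_eq_ofReal_abs, Real.enorm_eq_ofReal_abs, hHapp]
    refine ENNReal.ofReal_le_ofReal ?_
    by_cases hq : q ∈ A'
    · rw [indicator_of_mem hq]
      rcases le_total (g q) 1 with h1 | h1
      · rw [min_eq_left h1, abs_of_nonneg (sub_nonneg.2 (max_le h1 zero_le_one)),
          abs_of_nonneg (sub_nonneg.2 h1)]
        linarith [le_max_left (g q) 0]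
      · rw [min_eq_right h1, max_eq_left zero_le_one, sub_self, abs_zero]
        exact abs_nonneg _
    · rw [indicator_of_notMem hq, zero_sub, zero_sub, abs_neg, abs_neg,
        abs_of_nonneg (le_max_right _ _)]
      exact max_le ((min_le_left _ _).trans (le_abs_self _)) (abs_nonneg _)
  have hHm : Measurable fun p => H (torusPoint p) :=
    (H.continuous.comp continuous_torusPoint).measurable
  have hmax : Integrable (fun p => max (h p) 0) (volume.restrict D) := hh.pos_part
  have hHb : ∀ q, ‖H q‖ ≤ 1 := fun q => by
    rw [hHapp, Real.norm_of_nonneg (le_max_right _ _)]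
    exact max_le (min_le_right _ _) zero_le_one
  have hHh : Integrable (fun p => H (torusPoint p) * h p) (volume.restrict D) :=
    hh.bdd_mul hHm.aestronglyMeasurable (Eventually.of_forall fun p => hHb _)
  have hfm : Measurable fun q => ‖A'.indicator (fun _ => (1 : ℝ)) q - H q‖ₑ :=
    ((measurable_const.indicator hA'm).sub H.continuous.measurable).enorm
  have hle := abs_integral_sub_le_of_lintegral hmax hHh hδ.le ?_
  · linarith [(abs_le.1 hle).2]
  calc ∫⁻ p in D, ‖max (h p) 0 - H (torusPoint p) * h p‖ₑ
      = ∫⁻ p in D, ‖h' p‖ₑ *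
          ‖A'.indicator (fun _ => (1 : ℝ)) (torusPoint p) - H (torusPoint p)‖ₑ := by
        refine lintegral_congr_ae ?_
        filter_upwards [hae, ae_restrict_mem hD] with p hp hpD
        rw [hp, ← enorm_mul]
        congr 1
        by_cases hpos : 0 < h' p
        · rw [indicator_of_mem ((hA' p hpD).2 hpos), max_eq_left hpos.le]; ring
        · have : torusPoint p ∉ A' := fun hc => hpos ((hA' p hpD).1 hc)
          rw [indicator_of_notMem this, max_eq_right (not_lt.1 hpos)]; ring
    _ = ∫⁻ q, ‖A'.indicator (fun _ => (1 : ℝ)) q - H q‖ₑ ∂ν := by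
        rw [hν, lintegral_map hfm continuous_torusPoint.measurable]
        exact (lintegral_withDensity_eq_lintegral_mul _ hh'm.enorm
          (hfm.comp continuous_torusPoint.measurable)).symm
    _ ≤ _ := (lintegral_mono hHg).trans hg

/-- If all mixtures `∑ i, χ_i h_i` with continuous, periodic weights `χ_i ≥ 0`, `∑ i, χ_i ≤ 1`, have
integral at most `L`, then so has every function bounded by the maximum of `0` and the `h_i`. A
nearly optimal mixture cannot be improved by passing to a single `h_i`, or to `0`, on a set where
that is larger, and this bounds the integral of each positive part. -/
lemma integral_le_of_forall_mixture_le {N : ℕ} {Ω : Set (RSpace N)} (hΩ : MeasurableSet Ω)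
    {ι : Type*} [Fintype ι] {h : ι → RSpace N × RSpace N × RSpace N → ℝ}
    (hh : ∀ i, IntegrableOn (h i) (Ω ×ˢ (unitCube N ×ˢ unitCube N))) {L : ℝ}
    (hL : ∀ H : ι → BoundedContinuousFunction (RSpace N × Torus N × Torus N) ℝ,
      (∀ i q, 0 ≤ H i q) → (∀ q, ∑ i, H i q ≤ 1) →
      ∫ p in Ω ×ˢ (unitCube N ×ˢ unitCube N), ∑ i, H i (torusPoint p) * h i p ≤ L)
    {M : RSpace N × RSpace N × RSpace N → ℝ}
    (hMi : IntegrableOn M (Ω ×ˢ (unitCube N ×ˢ unitCube N)))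
    (hM : ∀ p, M p ≤ 0 ∨ ∃ i, M p ≤ h i p) :
    ∫ p in Ω ×ˢ (unitCube N ×ˢ unitCube N), M p ≤ L := by
  classical
  set D : Set (RSpace N × RSpace N × RSpace N) := Ω ×ˢ (unitCube N ×ˢ unitCube N) with hDdef
  have hint : ∀ (κ : BoundedContinuousFunction (RSpace N × Torus N × Torus N) ℝ)
      {g : RSpace N × RSpace N × RSpace N → ℝ}, IntegrableOn g D →
      IntegrableOn (fun p => κ (torusPoint p) * g p) D := fun κ g hg =>
    hg.bdd_mul (κ.continuous.comp continuous_torusPoint).aestronglyMeasurable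
      (Eventually.of_forall fun p => κ.norm_coe_le_norm _)
  let S : Set ℝ := {s | ∃ H : ι → BoundedContinuousFunction (RSpace N × Torus N × Torus N) ℝ,
    (∀ i q, 0 ≤ H i q) ∧ (∀ q, ∑ i, H i q ≤ 1) ∧
      ∫ p in D, ∑ i, H i (torusPoint p) * h i p = s}
  have hSne : S.Nonempty := ⟨_, fun _ => 0, by simp, by simp, rfl⟩
  have hSb : ∀ s ∈ S, s ≤ L := by
    rintro _ ⟨H, h0, h1, rfl⟩
    exact hL H h0 h1
  have hSbdd : BddAbove S := ⟨L, hSb⟩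
  have hSL : sSup S ≤ L := csSup_le hSne hSb
  have key : ∀ δ > 0, ∫ p in D, M p ≤ L + δ * (1 + 2 * (Fintype.card ι + 1)) := by
    intro δ hδ
    obtain ⟨_, ⟨H, hH0, hH1, rfl⟩, hHs⟩ := exists_lt_of_lt_csSup hSne (sub_lt_self (sSup S) hδ)
    set G : RSpace N × RSpace N × RSpace N → ℝ := fun p => ∑ i, H i (torusPoint p) * h i p with hG
    have hGi : IntegrableOn G D := integrable_finsetSum _ fun i _ => hint (H i) (hh i)
    -- replacing the mixture by another admissible function on part of the domain gains at most `δ`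
    have hgain : ∀ g : RSpace N × RSpace N × RSpace N → ℝ, IntegrableOn g D →
        (∀ κ : BoundedContinuousFunction (RSpace N × Torus N × Torus N) ℝ,
          (∀ q, 0 ≤ κ q) → (∀ q, κ q ≤ 1) →
          ∫ p in D, ((1 - κ (torusPoint p)) * G p + κ (torusPoint p) * g p) ∈ S) →
        ∫ p in D, max (g p - G p) 0 ≤ 2 * δ := by
      intro g hg hκS
      have hd : IntegrableOn (fun p => g p - G p) D := hg.sub hGi
      obtain ⟨κ, hκ0, hκ1, hκ⟩ := exists_cutoff_integral_ge hΩ hd hδ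
      have h1 := le_csSup hSbdd (hκS κ hκ0 hκ1)
      have h2 : ∫ p in D, ((1 - κ (torusPoint p)) * G p + κ (torusPoint p) * g p) =
          (∫ p in D, G p) + ∫ p in D, κ (torusPoint p) * (g p - G p) := by
        rw [← integral_add hGi (hint κ hd)]
        congr 1; ext p; ring
      linarith
    have hzero : ∫ p in D, max (0 - G p) 0 ≤ 2 * δ := by
      refine hgain (fun _ => 0) integrableOn_zero fun κ hκ0 hκ1 => ?_
      refine ⟨fun i => (1 - κ) * H i, fun i q => ?_, fun q => ?_, ?_⟩
      · exact mul_nonneg (sub_nonneg.2 (hκ1 q)) (hH0 i q)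
      · have e : ∀ i, ((1 - κ) * H i) q = (1 - κ q) * H i q := fun i => rfl
        simp only [e, ← Finset.mul_sum]
        exact mul_le_one₀ (by linarith [hκ0 q]) (Finset.sum_nonneg fun i _ => hH0 i q) (hH1 q)
      · congr 1; ext p
        have e : ∀ i, ((1 - κ) * H i) (torusPoint p) =
          (1 - κ (torusPoint p)) * H i (torusPoint p) := fun i => rfl
        simp only [e, hG, Finset.mul_sum, mul_zero, add_zero, mul_assoc]
    have hone : ∀ j, ∫ p in D, max (h j p - G p) 0 ≤ 2 * δ := by
      intro j
      refine hgain (h j) (hh j) fun κ hκ0 hκ1 => ?_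
      have e : ∀ i q, ((1 - κ) * H i + if i = j then κ else 0) q =
          (1 - κ q) * H i q + if i = j then κ q else 0 := fun i q => by
        by_cases hij : i = j <;> simp [hij]
      refine ⟨fun i => (1 - κ) * H i + if i = j then κ else 0, fun i q => ?_, fun q => ?_, ?_⟩
      · rw [e]
        refine add_nonneg (mul_nonneg (sub_nonneg.2 (hκ1 q)) (hH0 i q)) ?_
        split_ifs
        · exact hκ0 q
        · exact le_rfl
      · simp only [e, Finset.sum_add_distrib, ← Finset.mul_sum, Finset.sum_ite_eq',
          Finset.mem_univ, if_true]
        nlinarith [hκ0 q, hκ1 q, hH1 q]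
      · congr 1; ext p
        simp only [e, hG, Finset.mul_sum, add_mul, Finset.sum_add_distrib, ite_mul, zero_mul,
          Finset.sum_ite_eq', Finset.mem_univ, if_true, mul_assoc]
    have hGneg : IntegrableOn (fun p => max (0 - G p) 0) D := (integrableOn_zero.sub hGi).pos_part
    have hpos : ∀ i, IntegrableOn (fun p => max (h i p - G p) 0) D := fun i =>
      ((hh i).sub hGi).pos_part
    have hbound : ∀ p, M p ≤ G p + (max (0 - G p) 0 + ∑ i, max (h i p - G p) 0) := by
      intro p
      have hs : 0 ≤ ∑ i, max (h i p - G p) 0 := Finset.sum_nonneg fun i _ => le_max_right _ _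
      rcases hM p with h0 | ⟨i, hi⟩
      · linarith [le_max_left (0 - G p) 0]
      · have h1 : max (h i p - G p) 0 ≤ ∑ i, max (h i p - G p) 0 :=
          Finset.single_le_sum (f := fun i => max (h i p - G p) 0)
            (fun i _ => le_max_right _ _) (Finset.mem_univ i)
        linarith [le_max_left (h i p - G p) 0, le_max_right (0 - G p) 0]
    have hsumi : IntegrableOn (fun p => ∑ i, max (h i p - G p) 0) D :=
      integrable_finsetSum _ fun i _ => hpos i
    calc ∫ p in D, M p ≤ ∫ p in D, (G p + (max (0 - G p) 0 + ∑ i, max (h i p - G p) 0)) :=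
          integral_mono hMi (hGi.add (hGneg.add hsumi)) hbound
      _ = (∫ p in D, G p) + ((∫ p in D, max (0 - G p) 0) + ∑ i, ∫ p in D, max (h i p - G p) 0) := by
          rw [← integral_finsetSum _ fun i _ => hpos i, ← integral_add hGneg hsumi]
          exact integral_add hGi (hGneg.add hsumi)
      _ ≤ L + (2 * δ + ∑ _i : ι, 2 * δ) := by
          gcongr with i
          · exact (le_csSup hSbdd ⟨H, hH0, hH1, rfl⟩).trans hSL
          · exact hone i
      _ ≤ L + δ * (1 + 2 * (Fintype.card ι + 1)) := by
          simp only [Finset.sum_const, Finset.card_univ, nsmul_eq_mul]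
          nlinarith
  refine le_of_forall_pos_le_add fun δ hδ => ?_
  have hc : (0 : ℝ) < 1 + 2 * (Fintype.card ι + 1) := by positivity
  have := key (δ / (1 + 2 * (Fintype.card ι + 1))) (by positivity)
  rwa [div_mul_cancel₀ _ hc.ne'] at this

/-! ### Integrands on the torus -/

/-- A Carathéodory integrand on `(ℝ^N/ℤ^N)² × ℝ^d`: the exceptional sets of `IsIntegrand` have been
removed and periodicity is built into the domain. -/
structure IsTorusIntegrand {N d : ℕ} (B : ℝ → ℝ) (F : Torus N → Torus N → RSpace d → ℝ)
    (c₁ c₂ : ℝ) : Prop where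
  pos_left : 0 < c₁
  pos_right : 0 < c₂
  measurable : ∀ t' l, Measurable fun t => F t t' l
  continuous : ∀ t, Continuous fun q : Torus N × RSpace d => F t q.1 q.2
  convexOn : ∀ t t', ConvexOn ℝ univ (F t t')
  nonneg : ∀ t t' l, 0 ≤ F t t' l
  lower : ∀ t t' l, c₁ * B ‖l‖ ≤ F t t' l
  upper : ∀ t t' l, F t t' l ≤ c₂ * (1 + B ‖l‖)

/-- A family of convex functions that is locally uniformly bounded is locally uniformly Lipschitz,
so continuity in the parameter for a dense set of arguments upgrades to joint continuity. -/
lemma continuous_uncurry_of_convexOn {Z : Type*} [TopologicalSpace Z] {d : ℕ}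
    {φ : Z → RSpace d → ℝ} (hconv : ∀ z, ConvexOn ℝ univ (φ z)) {S : Set (RSpace d)}
    (hS : Dense S) (hcont : ∀ l ∈ S, Continuous fun z => φ z l)
    (hbdd : ∀ R : ℝ, ∃ M, ∀ z l, ‖l‖ ≤ R → |φ z l| ≤ M) :
    Continuous fun q : Z × RSpace d => φ q.1 q.2 := by
  rw [continuous_iff_continuousAt]
  rintro ⟨z, l⟩
  obtain ⟨M, hM⟩ := hbdd (‖l‖ + 2)
  have hLip : ∀ z', LipschitzOnWith (2 * M / 1).toNNReal (φ z')
      (Metric.ball 0 (‖l‖ + 2 - 1)) := fun z' =>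
    ((hconv z').subset (subset_univ _) (convex_ball _ _)).lipschitzOnWith_of_abs_le one_pos
      fun a ha => hM z' a (by rw [dist_zero_right] at ha; exact ha.le)
  set K : ℝ := ((2 * M / 1).toNNReal : ℝ) with hK
  have hK0 : 0 ≤ K := NNReal.coe_nonneg _
  rw [ContinuousAt, Metric.tendsto_nhds]
  intro δ hδ
  set ρ := min 1 (δ / (4 * (K + 1))) with hρ
  have hρ0 : 0 < ρ := lt_min one_pos (by positivity)
  have hρK : K * ρ ≤ δ / 4 := by
    calc K * ρ ≤ (K + 1) * (δ / (4 * (K + 1))) := by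
          gcongr
          · linarith
          · exact min_le_right _ _
      _ = δ / 4 := by field_simp
  obtain ⟨l₀, hl₀S, hl₀⟩ := Metric.mem_closure_iff.1 (hS l) ρ hρ0
  have hnear : ∀ l', dist l' l < 1 → l' ∈ Metric.ball (0 : RSpace d) (‖l‖ + 2 - 1) := by
    intro l' hl'
    rw [mem_ball_zero_iff]
    have := norm_le_norm_add_norm_sub' l' l
    rw [dist_eq_norm] at hl'
    linarith
  have h1 : ∀ᶠ q : Z × RSpace d in 𝓝 (z, l), dist (φ q.1 l₀) (φ z l₀) < δ / 4 :=
    Metric.tendsto_nhds.1 (((hcont l₀ hl₀S).comp continuous_fst).tendsto (z, l)) _ (by positivity)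
  have h2 : ∀ᶠ q : Z × RSpace d in 𝓝 (z, l), dist q.2 l < ρ :=
    Metric.tendsto_nhds.1 (continuous_snd.tendsto (z, l)) _ hρ0
  filter_upwards [h1, h2] with q h1 h2
  have hρ1 : ρ ≤ 1 := min_le_left _ _
  have m0 : l₀ ∈ Metric.ball (0 : RSpace d) (‖l‖ + 2 - 1) :=
    hnear l₀ (by rw [dist_comm]; exact hl₀.trans_le hρ1)
  have ml : l ∈ Metric.ball (0 : RSpace d) (‖l‖ + 2 - 1) := hnear l (by simp)
  have mq : q.2 ∈ Metric.ball (0 : RSpace d) (‖l‖ + 2 - 1) := hnear _ (h2.trans_le hρ1)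
  have e1 := (hLip q.1).dist_le_mul _ mq _ ml
  have e2 := (hLip q.1).dist_le_mul _ ml _ m0
  have e3 := (hLip z).dist_le_mul _ m0 _ ml
  rw [← hK] at e1 e2 e3
  rw [dist_comm l₀ l] at e3
  have f1 : K * dist q.2 l ≤ δ / 4 := (mul_le_mul_of_nonneg_left h2.le hK0).trans hρK
  have f2 : K * dist l l₀ ≤ δ / 4 := (mul_le_mul_of_nonneg_left hl₀.le hK0).trans hρK
  have t1 := dist_triangle4 (φ q.1 q.2) (φ q.1 l) (φ q.1 l₀) (φ z l₀)
  have t2 := dist_triangle (φ q.1 q.2) (φ z l₀) (φ z l)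
  linarith

lemma IsNFunction.continuous_comp_norm {B : ℝ → ℝ} (hB : IsNFunction B) (d : ℕ) :
    Continuous fun l : RSpace d => B ‖l‖ :=
  hB.continuousOn.comp_continuous continuous_norm fun l => norm_nonneg l

/-- Every `IsIntegrand` agrees, outside a null set of `y`, with an integrand on the torus. The null
sets belonging to a countable dense set of arguments and to all integer translations are collected
into one invariant null set, and on it a fixed good value of `y` is substituted. -/
lemma exists_isTorusIntegrand {N d : ℕ} {B : ℝ → ℝ} (hB : IsNFunction B)
    {f : RSpace N → RSpace N → RSpace d → ℝ} (hf : IsIntegrand B f) :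
    ∃ (F : Torus N → Torus N → RSpace d → ℝ) (c₁ c₂ : ℝ), IsTorusIntegrand B F c₁ c₂ ∧
      ∀ᵐ y, ∀ z l, f y z l = F (toTorus y) (toTorus z) l := by
  obtain ⟨c₁, c₂, hc₁, hc₂, hgr⟩ := hf.growth
  set u := TopologicalSpace.denseSeq (RSpace d) with hu
  set w := TopologicalSpace.denseSeq (RSpace N) with hw
  let g : ℕ → ℕ → RSpace N → ℝ := fun i j => (hf.measurable (u i) (w j)).mk _
  let P : RSpace N → Prop := fun y => (∀ i, Continuous fun z => f y z (u i)) ∧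
    (∀ z, ConvexOn ℝ univ (f y z)) ∧
    (∀ i z, c₁ * B ‖u i‖ ≤ f y z (u i) ∧ f y z (u i) ≤ c₂ * (1 + B ‖u i‖)) ∧
    (∀ (k h : Fin N → ℤ) (i j : ℕ), f (y + intVec k) (w j + intVec h) (u i) = f y (w j) (u i)) ∧
    (∀ i j, f y (w j) (u i) = g i j y)
  have hP : ∀ᵐ y, P y := by
    refine Filter.Eventually.and (ae_all_iff.2 fun i => hf.continuous (u i))
      (Filter.Eventually.and (hf.strictConvex.mono fun y hy z => (hy z).convexOn)
      (Filter.Eventually.and (ae_all_iff.2 fun i => hgr (u i)) (Filter.Eventually.and ?_ ?_)))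
    · exact ae_all_iff.2 fun k => ae_all_iff.2 fun h => ae_all_iff.2 fun i => ae_all_iff.2 fun j =>
        hf.periodic k h (w j) (u i)
    · exact ae_all_iff.2 fun i => ae_all_iff.2 fun j => (hf.measurable (u i) (w j)).ae_eq_mk
  obtain ⟨X, hXP, hXm, hX0⟩ := exists_measurable_superset_of_null (ae_iff.1 hP)
  let Gd : Set (RSpace N) := {y | ∀ k : Fin N → ℤ, y + intVec k ∉ X}
  have hGdm : MeasurableSet Gd := by
    have : Gd = ⋂ k : Fin N → ℤ, (fun y => y + intVec k) ⁻¹' Xᶜ := by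
      ext y; simp [Gd]
    rw [this]
    exact MeasurableSet.iInter fun k => (measurable_add_const _) hXm.compl
  have hGdae : ∀ᵐ y, y ∈ Gd := by
    refine ae_all_iff.2 fun k => ?_
    have hX : ∀ᵐ y, y ∉ X := measure_eq_zero_iff_ae_notMem.1 hX0
    exact (measurePreserving_add_right volume (intVec k)).quasiMeasurePreserving.ae hX
  have hGdadd : ∀ y ∈ Gd, ∀ k : Fin N → ℤ, y + intVec k ∈ Gd := by
    intro y hy k h
    have : y + intVec k + intVec h = y + intVec (k + h) := by
      ext i; simp [intVec, add_assoc]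
    rw [this]
    exact hy _
  have hGdP : ∀ y ∈ Gd, P y := by
    intro y hy
    by_contra hc
    have h0 : y + intVec (0 : Fin N → ℤ) = y := by ext i; simp [intVec]
    exact hy 0 (by rw [h0]; exact hXP hc)
  have hden : Dense (range u) := TopologicalSpace.denseRange_denseSeq _
  have hBc := hB.continuous_comp_norm d
  have hcl : ∀ y ∈ Gd, ∀ z, Continuous (f y z) := fun y hy z =>
    continuousOn_univ.1 (((hGdP y hy).2.1 z).continuousOn isOpen_univ)
  have hgrow : ∀ y ∈ Gd, ∀ z l, c₁ * B ‖l‖ ≤ f y z l ∧ f y z l ≤ c₂ * (1 + B ‖l‖) := by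
    intro y hy z
    have hclosed : IsClosed {l | c₁ * B ‖l‖ ≤ f y z l ∧ f y z l ≤ c₂ * (1 + B ‖l‖)} :=
      (isClosed_le (continuous_const.mul hBc) (hcl y hy z)).inter
        (isClosed_le (hcl y hy z) (continuous_const.mul (continuous_const.add hBc)))
    intro l
    exact isClosed_property (TopologicalSpace.denseRange_denseSeq (RSpace d)) hclosed
      (fun i => (hGdP y hy).2.2.1 i z) l
  have hcont : ∀ y ∈ Gd, Continuous fun q : RSpace N × RSpace d => f y q.1 q.2 := by
    intro y hy
    refine continuous_uncurry_of_convexOn (hGdP y hy).2.1 hden ?_ fun R => ?_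
    · rintro _ ⟨i, rfl⟩
      exact (hGdP y hy).1 i
    · refine ⟨c₂ * (1 + B (max R 0)), fun z l hl => ?_⟩
      rw [abs_of_nonneg (hf.nonneg _ _ _)]
      refine ((hgrow y hy z l).2).trans ?_
      gcongr
      exact hB.monotoneOn (norm_nonneg l) (le_max_right R 0) (hl.trans (le_max_left _ _))
  have hdenp : DenseRange fun p : ℕ × ℕ => (w p.1, u p.2) :=
    (TopologicalSpace.denseRange_denseSeq (RSpace N)).prodMap (TopologicalSpace.denseRange_denseSeq (RSpace d))
  have hper : ∀ y ∈ Gd, ∀ (k h : Fin N → ℤ) (z : RSpace N) (l : RSpace d),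
      f (y + intVec k) (z + intVec h) l = f y z l := by
    intro y hy k h z l
    have hclosed : IsClosed {q : RSpace N × RSpace d |
        f (y + intVec k) (q.1 + intVec h) q.2 = f y q.1 q.2} :=
      isClosed_eq ((hcont _ (hGdadd y hy k)).comp
        (by fun_prop : Continuous fun q : RSpace N × RSpace d => (q.1 + intVec h, q.2)))
        (hcont y hy)
    exact isClosed_property hdenp hclosed (fun p => (hGdP y hy).2.2.2.1 k h p.2 p.1) (z, l)
  obtain ⟨y₀, hy₀⟩ : ∃ y₀, y₀ ∈ Gd := hGdae.exists
  classical
  let s : Torus N → RSpace N := fun t => if torusSection t ∈ Gd then torusSection t else y₀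
  have hsm : Measurable s :=
    Measurable.ite (measurable_torusSection hGdm) measurable_torusSection measurable_const
  have hsG : ∀ t, s t ∈ Gd := fun t => by
    by_cases ht : torusSection t ∈ Gd <;> simp [s, ht, hy₀]
  have hper2 : ∀ y ∈ Gd, ∀ z l, f y (torusSection (toTorus z)) l = f y z l := by
    intro y hy z l
    obtain ⟨h, hh⟩ := exists_eq_add_intVec (toTorus_torusSection (toTorus z))
    have h0 : y + intVec (0 : Fin N → ℤ) = y := by ext i; simp [intVec]
    rw [hh]
    simpa only [h0] using hper y hy 0 h z l
  refine ⟨fun t t' l => f (s t) (torusSection t') l, c₁, c₂, ⟨hc₁, hc₂, fun t' l => ?_, fun t => ?_,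
    fun t t' => (hGdP _ (hsG t)).2.1 _, fun _ _ _ => hf.nonneg _ _ _,
    fun t t' l => (hgrow _ (hsG t) _ l).1, fun t t' l => (hgrow _ (hsG t) _ l).2⟩, ?_⟩
  · obtain ⟨x, hx, hxlim⟩ := mem_closure_iff_seq_limit.1 (hdenp (torusSection t', l))
    choose p hp using hx
    refine measurable_of_tendsto_metrizable (f := fun n t => g (p n).2 (p n).1 (s t))
      (fun n => ((hf.measurable _ _).measurable_mk).comp hsm) (tendsto_pi_nhds.2 fun t => ?_)
    have h1 := ((hcont _ (hsG t)).tendsto (torusSection t', l)).comp hxlim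
    refine h1.congr fun n => ?_
    simp only [Function.comp_apply, ← hp n]
    exact (hGdP _ (hsG t)).2.2.2.2 _ _
  · have hq : IsQuotientMap (Prod.map (toTorus (N := N)) (id : RSpace d → RSpace d)) :=
      (isOpenMap_toTorus.prodMap IsOpenMap.id).isQuotientMap
        (continuous_toTorus.prodMap continuous_id)
        (surjective_toTorus.prodMap Function.surjective_id)
    rw [hq.continuous_iff]
    refine (hcont _ (hsG t)).congr fun q => ?_
    exact (hper2 _ (hsG t) q.1 q.2).symm
  · filter_upwards [hGdae] with y hy z l
    obtain ⟨k, hk⟩ := exists_eq_add_intVec (toTorus_torusSection (toTorus y))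
    have h1 : torusSection (toTorus y) ∈ Gd := by rw [hk]; exact hGdadd y hy k
    have h2 : s (toTorus y) = y + intVec k := by simp only [s, if_pos h1]; exact hk
    obtain ⟨h, hh⟩ := exists_eq_add_intVec (toTorus_torusSection (toTorus z))
    simp only [h2, hh]
    exact (hper y hy k h z l).symm

/-! ### Local affine minorants -/

/-- The best constant `a t` for which `⟪q, l⟫ - a t ≤ F t t' l` holds for all `l` and all `t'` in the
ball `B(c, r)`, written as a countable supremum. Since `t'` has been absorbed, it only depends on
the variable in which `F` is merely measurable. -/
noncomputable def localConj {N d : ℕ} (F : Torus N → Torus N → RSpace d → ℝ) (q : RSpace d)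
    (c : Torus N) {r : ℝ} (hr : 0 < r) (t : Torus N) : ℝ :=
  haveI : Nonempty (Metric.ball c r) := ⟨⟨c, Metric.mem_ball_self hr⟩⟩
  ⨆ n : ℕ, (inner ℝ q (TopologicalSpace.denseSeq (Metric.ball c r × RSpace d) n).2 -
    F t (TopologicalSpace.denseSeq (Metric.ball c r × RSpace d) n).1
      (TopologicalSpace.denseSeq (Metric.ball c r × RSpace d) n).2)

section LocalConj

variable {N d : ℕ} {B : ℝ → ℝ} {F : Torus N → Torus N → RSpace d → ℝ} {c₁ c₂ : ℝ}

lemma IsTorusIntegrand.exists_inner_sub_le (hB : IsNFunction B) (hF : IsTorusIntegrand B F c₁ c₂)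
    (q : RSpace d) : ∃ C, 0 ≤ C ∧ ∀ t t' l, inner ℝ q l - F t t' l ≤ C := by
  obtain ⟨C, hC0, hC⟩ := hB.exists_mul_le_add ‖q‖ hF.pos_left
  refine ⟨C, hC0, fun t t' l => ?_⟩
  have h1 := real_inner_le_norm q l
  have h2 := hC ‖l‖ (norm_nonneg l)
  have h3 := hF.lower t t' l
  linarith

lemma localConj_le (q : RSpace d) (c : Torus N) {r : ℝ} (hr : 0 < r) {t : Torus N} {b : ℝ}
    (hb : ∀ t' ∈ Metric.ball c r, ∀ l, inner ℝ q l - F t t' l ≤ b) :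
    localConj F q c hr t ≤ b :=
  ciSup_le fun _ => hb _ (Subtype.coe_prop _) _

lemma IsTorusIntegrand.inner_sub_localConj_le (hB : IsNFunction B)
    (hF : IsTorusIntegrand B F c₁ c₂) (q : RSpace d) (c : Torus N) {r : ℝ} (hr : 0 < r)
    (t : Torus N) {t' : Torus N} (ht' : t' ∈ Metric.ball c r) (l : RSpace d) :
    inner ℝ q l - localConj F q c hr t ≤ F t t' l := by
  have : Nonempty (Metric.ball c r) := ⟨⟨c, Metric.mem_ball_self hr⟩⟩
  have hclosed : IsClosed {p : Metric.ball c r × RSpace d |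
      inner ℝ q p.2 - F t p.1 p.2 ≤ localConj F q c hr t} := by
    refine isClosed_le (Continuous.sub (by fun_prop) ?_) continuous_const
    exact (hF.continuous t).comp
      (by fun_prop : Continuous fun p : Metric.ball c r × RSpace d => ((p.1 : Torus N), p.2))
  obtain ⟨C, -, hC⟩ := hF.exists_inner_sub_le hB q
  have h := isClosed_property (TopologicalSpace.denseRange_denseSeq (Metric.ball c r × RSpace d))
    hclosed (fun n => le_ciSup (f := fun n : ℕ =>
      (inner ℝ q (TopologicalSpace.denseSeq (Metric.ball c r × RSpace d) n).2 -
        F t (TopologicalSpace.denseSeq (Metric.ball c r × RSpace d) n).1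
          (TopologicalSpace.denseSeq (Metric.ball c r × RSpace d) n).2))
      ⟨C, by rintro _ ⟨n, rfl⟩; exact hC _ _ _⟩ n) (⟨t', ht'⟩, l)
  simp only at h
  linarith

lemma IsTorusIntegrand.measurable_localConj (hF : IsTorusIntegrand B F c₁ c₂) (q : RSpace d)
    (c : Torus N) {r : ℝ} (hr : 0 < r) : Measurable (localConj F q c hr) :=
  Measurable.iSup fun _ => measurable_const.sub (hF.measurable _ _)

lemma IsTorusIntegrand.exists_abs_localConj_le (hB : IsNFunction B)
    (hF : IsTorusIntegrand B F c₁ c₂) (q : RSpace d) (c : Torus N) {r : ℝ} (hr : 0 < r) :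
    ∃ A, ∀ t, |localConj F q c hr t| ≤ A := by
  obtain ⟨C, hC0, hC⟩ := hF.exists_inner_sub_le hB q
  refine ⟨C + c₂, fun t => abs_le.2 ⟨?_, ?_⟩⟩
  · have h1 := hF.inner_sub_localConj_le hB q c hr t (Metric.mem_ball_self hr) 0
    have h2 := hF.upper t c 0
    rw [norm_zero, hB.map_zero, add_zero, mul_one] at h2
    rw [inner_zero_right] at h1
    linarith
  · have h1 := localConj_le (F := F) q c hr (t := t) fun t' _ l => hC t t' l
    linarith [hF.pos_right]

/-- A continuous cut-off on the torus, equal to `1` on `B(c, r/2)` and to `0` outside `B(c, r)`. -/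
noncomputable def torusBump {N : ℕ} (c : Torus N) (r : ℝ) (t : Torus N) : ℝ :=
  max 0 (min 1 (2 - 2 * dist t c / r))

lemma torusBump_nonneg (c : Torus N) (r : ℝ) (t : Torus N) : 0 ≤ torusBump c r t :=
  le_max_left _ _

lemma torusBump_le_one (c : Torus N) (r : ℝ) (t : Torus N) : torusBump c r t ≤ 1 :=
  max_le zero_le_one (min_le_left _ _)

lemma continuous_torusBump (c : Torus N) (r : ℝ) : Continuous (torusBump c r) := by
  unfold torusBump
  fun_prop

lemma torusBump_eq_zero {c : Torus N} {r : ℝ} (hr : 0 < r) {t : Torus N}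
    (ht : t ∉ Metric.ball c r) : torusBump c r t = 0 := by
  rw [Metric.mem_ball, not_lt] at ht
  refine max_eq_left ((min_le_right _ _).trans ?_)
  rw [sub_nonpos, le_div_iff₀ hr]
  linarith

lemma torusBump_eq_one {c : Torus N} {r : ℝ} (hr : 0 < r) {t : Torus N}
    (ht : dist t c ≤ r / 2) : torusBump c r t = 1 := by
  have : 1 ≤ 2 - 2 * dist t c / r := by
    rw [le_sub_comm, div_le_iff₀ hr]
    linarith
  rw [torusBump, min_eq_left this, max_eq_right zero_le_one]

/-- The local affine minorant of `F` with slope `q` near `c`, cut off in the second variable. -/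
noncomputable def localMinorant (F : Torus N → Torus N → RSpace d → ℝ) (q : RSpace d)
    (c : Torus N) {r : ℝ} (hr : 0 < r) (t t' : Torus N) (l : RSpace d) : ℝ :=
  torusBump c r t' * (inner ℝ q l - localConj F q c hr t)

lemma IsTorusIntegrand.localMinorant_le (hB : IsNFunction B)
    (hF : IsTorusIntegrand B F c₁ c₂) (q : RSpace d) (c : Torus N) {r : ℝ} (hr : 0 < r)
    (t t' : Torus N) (l : RSpace d) : localMinorant F q c hr t t' l ≤ F t t' l := by
  by_cases ht' : t' ∈ Metric.ball c r
  · exact (mul_le_mul_of_nonneg_left (hF.inner_sub_localConj_le hB q c hr t ht' l)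
      (torusBump_nonneg _ _ _)).trans
      (mul_le_of_le_one_left (hF.nonneg _ _ _) (torusBump_le_one _ _ _))
  · rw [localMinorant, torusBump_eq_zero hr ht', zero_mul]
    exact hF.nonneg _ _ _

/-- The local affine minorants with slope, centre and radius in countable dense sets recover `F`.
An affine minorant of `F t t'` that is nearly exact at `l₀` remains a minorant up to a small error
when its slope and `t'` are perturbed: for bounded `l` by uniform continuity, and for large `l` by
the superlinear growth of `F`. -/
lemma IsTorusIntegrand.exists_lt_localMinorant (hB : IsNFunction B)
    (hF : IsTorusIntegrand B F c₁ c₂) (t t' : Torus N) (l₀ : RSpace d) {δ : ℝ} (hδ : 0 < δ) :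
    ∃ i j k : ℕ, F t t' l₀ - δ < localMinorant F (TopologicalSpace.denseSeq (RSpace d) i)
      (TopologicalSpace.denseSeq (Torus N) j) (Nat.one_div_pos_of_nat (α := ℝ) (n := k))
      t t' l₀ := by
  have hcl : Continuous (F t t') := (hF.continuous t).comp (by fun_prop : Continuous fun l => (t', l))
  obtain ⟨Λ, b, hΛ, hΛ₀⟩ := (hF.convexOn t t').exists_affine_le_of_lt (𝕜 := ℝ) (mem_univ l₀)
    (show F t t' l₀ - δ / 4 < F t t' l₀ by linarith) isClosed_univ
    (hcl.lowerSemicontinuous.lowerSemicontinuousOn _)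
  set q₀ := (InnerProductSpace.toDual ℝ (RSpace d)).symm Λ with hq₀
  have hq₀Λ : ∀ l, inner ℝ q₀ l = Λ l := fun l => InnerProductSpace.toDual_symm_apply
  set a₀ := F t t' l₀ - δ / 4 with ha₀
  have hmin : ∀ l, a₀ + inner ℝ q₀ (l - l₀) ≤ F t t' l := by
    intro l
    have h1 := hΛ ⟨l, mem_univ l⟩
    simp only [Pi.add_apply, Function.const_apply, domRestrict_apply, Function.comp_apply,
      RCLike.re_to_real] at h1
    rw [inner_sub_right, hq₀Λ, hq₀Λ]
    rw [RCLike.re_to_real] at hΛ₀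
    linarith
  obtain ⟨C, hC0, hC⟩ := hB.exists_mul_le_add (‖q₀‖ + 2) hF.pos_left
  set R := C + |a₀| + (‖q₀‖ + 1) * ‖l₀‖ with hR
  have hR0 : 0 ≤ R := by positivity
  have hlarge : ∀ q : RSpace d, ‖q - q₀‖ ≤ 1 → ∀ t'' l, R ≤ ‖l‖ →
      a₀ + inner ℝ q (l - l₀) ≤ F t t'' l := by
    intro q hq t'' l hl
    have h1 := hF.lower t t'' l
    have h2 := hC ‖l‖ (norm_nonneg l)
    have h3 : ‖q‖ ≤ ‖q₀‖ + 1 := by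
      have := norm_le_norm_add_norm_sub' q q₀
      linarith
    have h4 : inner ℝ q (l - l₀) ≤ (‖q₀‖ + 1) * (‖l‖ + ‖l₀‖) :=
      (real_inner_le_norm _ _).trans
        (mul_le_mul h3 (norm_sub_le _ _) (norm_nonneg _) (by positivity))
    have h5 := le_abs_self a₀
    nlinarith
  -- uniform continuity on the compact set of bounded `l`
  have hK : IsCompact ((univ : Set (Torus N)) ×ˢ Metric.closedBall (0 : RSpace d) R) :=
    isCompact_univ.prod (isCompact_closedBall _ _)
  obtain ⟨ρ, hρ, hρF⟩ := Metric.uniformContinuousOn_iff.1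
    (hK.uniformContinuousOn_of_continuous (hF.continuous t).continuousOn) (δ / 4) (by positivity)
  have hsmall : ∀ t'', dist t'' t' < ρ → ∀ l, ‖l‖ ≤ R → F t t' l - δ / 4 ≤ F t t'' l := by
    intro t'' ht'' l hl
    have hl' : l ∈ Metric.closedBall (0 : RSpace d) R := by simpa using hl
    have := hρF (t'', l) ⟨mem_univ _, hl'⟩ (t', l) ⟨mem_univ _, hl'⟩
      (by rw [Prod.dist_eq, dist_self]; exact max_lt ht'' hρ)
    rw [Real.dist_eq, abs_lt] at this
    linarith [this.1]
  obtain ⟨k, hk⟩ := exists_nat_one_div_lt (show (0 : ℝ) < ρ / 2 by positivity)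
  set r : ℝ := 1 / ((k : ℝ) + 1) with hr
  have hr0 : 0 < r := Nat.one_div_pos_of_nat
  obtain ⟨j, hj⟩ := (TopologicalSpace.denseRange_denseSeq (Torus N)).exists_dist_lt t'
    (show 0 < r / 2 by positivity)
  have hη : 0 < min 1 (δ / (4 * (R + ‖l₀‖ + 1))) := lt_min one_pos (by positivity)
  obtain ⟨i, hi⟩ := (TopologicalSpace.denseRange_denseSeq (RSpace d)).exists_dist_lt q₀ hη
  refine ⟨i, j, k, ?_⟩
  set q := TopologicalSpace.denseSeq (RSpace d) i with hq
  set c := TopologicalSpace.denseSeq (Torus N) j with hc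
  rw [dist_comm, dist_eq_norm] at hi
  have hi1 : ‖q - q₀‖ ≤ 1 := hi.le.trans (min_le_left _ _)
  have hi2 : ‖q - q₀‖ * (R + ‖l₀‖) ≤ δ / 4 := by
    calc ‖q - q₀‖ * (R + ‖l₀‖) ≤ (δ / (4 * (R + ‖l₀‖ + 1))) * (R + ‖l₀‖ + 1) :=
          mul_le_mul (hi.le.trans (min_le_right _ _)) (by linarith) (by positivity) (by positivity)
      _ = δ / 4 := by field_simp
  have hconj : localConj F q c hr0 t ≤ inner ℝ q l₀ - a₀ + δ / 2 := by
    refine localConj_le q c hr0 fun t'' ht'' l => ?_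
    have hd : dist t'' t' < ρ := by
      have h1 := dist_triangle t'' c t'
      rw [Metric.mem_ball] at ht''
      rw [dist_comm] at hj
      linarith
    have hsub : inner ℝ q (l - l₀) = inner ℝ q l - inner ℝ q l₀ := inner_sub_right _ _ _
    rcases le_total R ‖l‖ with hl | hl
    · have := hlarge q hi1 t'' l hl
      linarith
    · have h1 := hsmall t'' hd l hl
      have h2 := hmin l
      have h3 : inner ℝ (q - q₀) (l - l₀) ≤ δ / 4 := by
        refine (real_inner_le_norm _ _).trans (le_trans ?_ hi2)
        gcongr
        exact (norm_sub_le _ _).trans (by linarith)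
      rw [inner_sub_left] at h3
      linarith
  rw [localMinorant, torusBump_eq_one hr0 hj.le, one_mul]
  linarith

end LocalConj

/-! ### Integrability in Orlicz spaces -/

lemma MemOrlicz.lintegral_lt_top {α : Type*} [MeasurableSpace α] {μ : Measure α}
    [IsFiniteMeasure μ] {B : ℝ → ℝ} (hB : IsNFunction B) (hB2 : DeltaTwo B) {u : α → ℝ}
    (hu : MemOrlicz B μ u) : ∫⁻ x, ENNReal.ofReal (B |u x|) ∂μ < ⊤ := by
  obtain ⟨δ, hδ1, hδ0⟩ : ∃ δ : ℝ, ∫⁻ x, ENNReal.ofReal (B (δ * |u x|)) ∂μ < 1 ∧ 0 < δ :=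
    ((hu.2.eventually_lt_const one_pos).and self_mem_nhdsWithin).exists
  obtain ⟨C, hC0, hC⟩ := hB.exists_dilation_le hB2 (inv_nonneg.2 hδ0.le)
  have hpt : ∀ x, ENNReal.ofReal (B |u x|) ≤
      ENNReal.ofReal C * (1 + ENNReal.ofReal (B (δ * |u x|))) := by
    intro x
    have h0 : 0 ≤ δ * |u x| := by positivity
    have h1 := hC (δ * |u x|) h0
    rw [inv_mul_cancel_left₀ hδ0.ne'] at h1
    rw [← ENNReal.ofReal_one, ← ENNReal.ofReal_add zero_le_one (hB.nonneg h0),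
      ← ENNReal.ofReal_mul hC0]
    exact ENNReal.ofReal_le_ofReal h1
  calc ∫⁻ x, ENNReal.ofReal (B |u x|) ∂μ
      ≤ ∫⁻ x, ENNReal.ofReal C * (1 + ENNReal.ofReal (B (δ * |u x|))) ∂μ := lintegral_mono hpt
    _ = ENNReal.ofReal C * (μ univ + ∫⁻ x, ENNReal.ofReal (B (δ * |u x|)) ∂μ) := by
        rw [lintegral_const_mul' _ _ ENNReal.ofReal_ne_top, lintegral_add_left measurable_const,
          lintegral_one]
    _ < ⊤ := ENNReal.mul_lt_top ENNReal.ofReal_lt_top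
        (ENNReal.add_lt_top.2 ⟨measure_lt_top _ _, hδ1.trans ENNReal.one_lt_top⟩)

lemma IsNFunction.integrable_abs {α : Type*} [MeasurableSpace α] {μ : Measure α}
    {B : ℝ → ℝ} (hB : IsNFunction B) {u : α → ℝ} (hu : AEStronglyMeasurable u μ)
    (hfin : ∫⁻ x, ENNReal.ofReal (B |u x|) ∂μ < ⊤) : Integrable (fun x => B |u x|) μ := by
  have hc : Continuous fun t : ℝ => B |t| :=
    hB.continuousOn.comp_continuous continuous_abs abs_nonneg
  refine ⟨hc.comp_aestronglyMeasurable hu, ?_⟩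
  rw [hasFiniteIntegral_iff_ofReal (Eventually.of_forall fun x => hB.nonneg (abs_nonneg _))]
  exact hfin

lemma IsNFunction.integrable {α : Type*} [MeasurableSpace α] {μ : Measure α} [IsFiniteMeasure μ]
    {B : ℝ → ℝ} (hB : IsNFunction B) {u : α → ℝ} (hu : AEStronglyMeasurable u μ)
    (hfin : ∫⁻ x, ENNReal.ofReal (B |u x|) ∂μ < ⊤) : Integrable u μ := by
  obtain ⟨C, hC0, hC⟩ := hB.exists_mul_le_add 1 one_pos
  refine ((hB.integrable_abs hu hfin).add (integrable_const C)).mono' hu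
    (Eventually.of_forall fun x => ?_)
  have := hC |u x| (abs_nonneg _)
  rw [one_mul, one_mul] at this
  exact this

lemma IsNFunction.exists_add_le {B : ℝ → ℝ} (hB : IsNFunction B) (hB2 : DeltaTwo B) :
    ∃ C : ℝ, 0 ≤ C ∧ ∀ s t, 0 ≤ s → 0 ≤ t → B (s + t) ≤ C * (1 + (B s + B t)) := by
  obtain ⟨C, hC0, hC⟩ := hB.exists_dilation_le hB2 zero_le_two
  refine ⟨C, hC0, fun s t hs ht => ?_⟩
  have key : ∀ m, 0 ≤ m → s ≤ m → t ≤ m → B m ≤ B s + B t → B (s + t) ≤ C * (1 + (B s + B t)) := by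
    intro m hm hsm htm hBm
    refine (hB.monotoneOn (mem_Ici.2 (by positivity)) (mem_Ici.2 (by positivity : 0 ≤ 2 * m))
      (by linarith)).trans ((hC m hm).trans ?_)
    gcongr
  rcases le_total s t with h | h
  · exact key t ht h le_rfl (by linarith [hB.nonneg hs])
  · exact key s hs le_rfl h (by linarith [hB.nonneg ht])

lemma IsNFunction.exists_one_add_norm_le {B : ℝ → ℝ} (hB : IsNFunction B) (hB2 : DeltaTwo B)
    (d : ℕ) : ∃ C : ℝ, 0 ≤ C ∧ ∀ l : RSpace d, B (1 + ‖l‖) ≤ C * (1 + ∑ j, B |l j|) := by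
  obtain ⟨C, hC0, hC⟩ := hB.exists_add_le hB2
  have key : ∀ J : Finset (Fin d), ∃ D : ℝ, 0 ≤ D ∧ ∀ l : RSpace d,
      B (1 + ∑ j ∈ J, |l j|) ≤ D * (1 + ∑ j ∈ J, B |l j|) := by
    intro J
    induction J using Finset.induction_on with
    | empty => exact ⟨B 1, hB.nonneg zero_le_one, fun l => by simp⟩
    | insert i J hi ih =>
      obtain ⟨D, hD0, hD⟩ := ih
      refine ⟨C * (1 + D), by positivity, fun l => ?_⟩
      rw [Finset.sum_insert hi, Finset.sum_insert hi, add_left_comm]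
      have hs : 0 ≤ ∑ j ∈ J, |l j| := Finset.sum_nonneg fun j _ => abs_nonneg _
      have hs' : 0 ≤ ∑ j ∈ J, B |l j| := Finset.sum_nonneg fun j _ => hB.nonneg (abs_nonneg _)
      have hi0 : 0 ≤ B |l i| := hB.nonneg (abs_nonneg _)
      have h1 := hC |l i| (1 + ∑ j ∈ J, |l j|) (abs_nonneg _) (by positivity)
      have h2 := hD l
      refine h1.trans ?_
      rw [mul_assoc]
      refine mul_le_mul_of_nonneg_left ?_ hC0
      nlinarith [mul_nonneg hD0 hi0]
  obtain ⟨D, hD0, hD⟩ := key Finset.univ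
  refine ⟨D, hD0, fun l => (hB.monotoneOn ?_ ?_ ?_).trans (hD l)⟩
  · exact mem_Ici.2 (by positivity)
  · exact mem_Ici.2 (by positivity)
  · have : l = ∑ i, EuclideanSpace.single i (l i) := by
      ext j; simp [Finset.sum_apply]
    gcongr
    conv_lhs => rw [this]
    exact (norm_sum_le _ _).trans (Finset.sum_le_sum fun i _ => by simp)

lemma aestronglyMeasurable_of_components {α : Type*} [MeasurableSpace α] {μ : Measure α} {d : ℕ}
    {w : α → RSpace d} (hw : ∀ j, AEStronglyMeasurable (fun x => w x j) μ) :
    AEStronglyMeasurable w μ :=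
  ((MeasurableEquiv.toLp 2 (Fin d → ℝ)).measurable.comp_aemeasurable
    (aemeasurable_pi_lambda (fun x => (w x).ofLp) fun j =>
      (hw j).aemeasurable)).aestronglyMeasurable

lemma IsNFunction.integrable_one_add_norm {α : Type*} [MeasurableSpace α] {μ : Measure α}
    [IsFiniteMeasure μ] {B : ℝ → ℝ} (hB : IsNFunction B) (hB2 : DeltaTwo B) {d : ℕ}
    {w : α → RSpace d} (hw : ∀ j, AEStronglyMeasurable (fun x => w x j) μ)
    (hfin : ∀ j, ∫⁻ x, ENNReal.ofReal (B |w x j|) ∂μ < ⊤) :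
    Integrable (fun x => B (1 + ‖w x‖)) μ := by
  obtain ⟨C, hC0, hC⟩ := hB.exists_one_add_norm_le hB2 d
  have hc : Continuous fun l : RSpace d => B (1 + ‖l‖) :=
    hB.continuousOn.comp_continuous (by fun_prop) fun l => mem_Ici.2 (by positivity)
  have hb : Integrable (fun x => C * (1 + ∑ j, B |w x j|)) μ :=
    ((integrable_const 1).add
      (integrable_finsetSum _ fun j _ => hB.integrable_abs (hw j) (hfin j))).const_mul C
  refine hb.mono' (hc.comp_aestronglyMeasurable (aestronglyMeasurable_of_components hw))
    (Eventually.of_forall fun x => ?_)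
  rw [Real.norm_of_nonneg (hB.nonneg (by positivity))]
  exact hC _

lemma IsNFunction.norm_le_one_add_norm {B : ℝ → ℝ} (hB : IsNFunction B) {d : ℕ} (l : RSpace d) :
    B ‖l‖ ≤ B (1 + ‖l‖) :=
  hB.monotoneOn (norm_nonneg l) (mem_Ici.2 (by positivity)) (by linarith)

lemma IsNFunction.integrable_of_components {α : Type*} [MeasurableSpace α] {μ : Measure α}
    [IsFiniteMeasure μ] {B : ℝ → ℝ} (hB : IsNFunction B) (hB2 : DeltaTwo B) {d : ℕ}
    {w : α → RSpace d} (hw : ∀ j, AEStronglyMeasurable (fun x => w x j) μ)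
    (hfin : ∀ j, ∫⁻ x, ENNReal.ofReal (B |w x j|) ∂μ < ⊤) : Integrable w μ := by
  obtain ⟨C, hC0, hC⟩ := hB.exists_mul_le_add 1 one_pos
  refine ((hB.integrable_one_add_norm hB2 hw hfin).add (integrable_const C)).mono'
    (aestronglyMeasurable_of_components hw) (Eventually.of_forall fun x => ?_)
  have := hC (1 + ‖w x‖) (by positivity)
  simp only [Pi.add_apply]
  linarith

lemma IsTorusIntegrand.measurable_uncurry {N d : ℕ} {B : ℝ → ℝ}
    {F : Torus N → Torus N → RSpace d → ℝ} {c₁ c₂ : ℝ} (hF : IsTorusIntegrand B F c₁ c₂) :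
    Measurable fun p : Torus N × Torus N × RSpace d => F p.1 p.2.1 p.2.2 :=
  (measurable_uncurry_of_continuous_of_measurable
    (u := fun (q : Torus N × RSpace d) (t : Torus N) => F t q.1 q.2) hF.continuous
    fun q => hF.measurable q.1 q.2).comp measurable_swap

lemma IsTorusIntegrand.integrable_comp {α : Type*} [MeasurableSpace α] {μ : Measure α}
    [IsFiniteMeasure μ] {N d : ℕ} {B : ℝ → ℝ} (hB : IsNFunction B) (hB2 : DeltaTwo B)
    {F : Torus N → Torus N → RSpace d → ℝ} {c₁ c₂ : ℝ} (hF : IsTorusIntegrand B F c₁ c₂)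
    {a b : α → Torus N} (ha : Measurable a) (hb : Measurable b) {w : α → RSpace d}
    (hw : ∀ j, AEStronglyMeasurable (fun x => w x j) μ)
    (hfin : ∀ j, ∫⁻ x, ENNReal.ofReal (B |w x j|) ∂μ < ⊤) :
    Integrable (fun x => F (a x) (b x) (w x)) μ := by
  have hi := hB.integrable_one_add_norm hB2 hw hfin
  refine (((integrable_const (1 : ℝ)).add hi).const_mul c₂).mono' ?_
    (Eventually.of_forall fun x => ?_)
  · exact (hF.measurable_uncurry.comp_aemeasurable (ha.aemeasurable.prodMk
      (hb.aemeasurable.prodMk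
        (aestronglyMeasurable_of_components hw).aemeasurable))).aestronglyMeasurable
  · rw [Real.norm_of_nonneg (hF.nonneg _ _ _)]
    refine (hF.upper _ _ _).trans (mul_le_mul_of_nonneg_left ?_ hF.pos_right.le)
    simp only [Pi.add_apply]
    linarith [hB.norm_le_one_add_norm (w x)]

/-! ### Mollification -/

section Mollification

variable {N d m : ℕ} {B : ℝ → ℝ} {F : Torus N → Torus N → RSpace d → ℝ} {c₁ c₂ : ℝ}
  {θ : RSpace d → ℝ}

lemma IsSymmMollifier.hasCompactSupport (hθ : IsSymmMollifier m θ) : HasCompactSupport θ :=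
  (isCompact_closedBall _ _).of_isClosed_subset (isClosed_tsupport θ) hθ.support

lemma IsTorusIntegrand.measurable_mollified (hF : IsTorusIntegrand B F c₁ c₂)
    (hθ : IsSymmMollifier m θ) :
    Measurable fun p : Torus N × Torus N × RSpace d => ∫ η, θ η * F p.1 p.2.1 (p.2.2 - η) := by
  have h : StronglyMeasurable (Function.uncurry fun (p : Torus N × Torus N × RSpace d)
      (η : RSpace d) => θ η * F p.1 p.2.1 (p.2.2 - η)) := by
    refine Measurable.stronglyMeasurable (Measurable.mul ?_ ?_)
    · exact hθ.smooth.continuous.measurable.comp measurable_snd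
    · exact hF.measurable_uncurry.comp (by fun_prop :
        Measurable fun p : (Torus N × Torus N × RSpace d) × RSpace d =>
          (p.1.1, p.1.2.1, p.1.2.2 - p.2))
  exact h.integral_prod_right.measurable

lemma IsTorusIntegrand.mollified_nonneg (hF : IsTorusIntegrand B F c₁ c₂)
    (hθ : IsSymmMollifier m θ) (t t' : Torus N) (l : RSpace d) :
    0 ≤ ∫ η, θ η * F t t' (l - η) :=
  integral_nonneg fun η => mul_nonneg (hθ.nonneg η) (hF.nonneg _ _ _)

/-- Mollification at scale `1/m` increases a convex integrand with `B`-growth by at most `O(1/m)`: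
write `l - η` as a convex combination of `l` and `l - m η` with weights `1 - 1/m` and `1/m`. -/
lemma IsTorusIntegrand.mollified_le (hB : IsNFunction B) (hF : IsTorusIntegrand B F c₁ c₂)
    (hm : 1 ≤ m) (hθ : IsSymmMollifier m θ) (t t' : Torus N) (l : RSpace d) :
    ∫ η, θ η * F t t' (l - η) ≤ F t t' l + c₂ * (1 + B (1 + ‖l‖)) / m := by
  have hm0 : (0 : ℝ) < m := by exact_mod_cast hm
  have hm1 : (1 : ℝ) ≤ m := by exact_mod_cast hm
  set K := F t t' l + c₂ * (1 + B (1 + ‖l‖)) / m with hK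
  have hpt : ∀ η, θ η * F t t' (l - η) ≤ θ η * K := by
    intro η
    by_cases h0 : θ η = 0
    · simp [h0]
    refine mul_le_mul_of_nonneg_left ?_ (hθ.nonneg η)
    have hη : ‖η‖ ≤ 1 / m := by simpa using hθ.support (subset_tsupport θ h0)
    have hcomb : (1 - (m : ℝ)⁻¹) • l + (m : ℝ)⁻¹ • (l - (m : ℝ) • η) = l - η := by
      rw [smul_sub, smul_smul, inv_mul_cancel₀ hm0.ne', one_smul, sub_smul, one_smul]
      abel
    have hconv := (hF.convexOn t t').2 (mem_univ l) (mem_univ (l - (m : ℝ) • η))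
      (sub_nonneg.2 (inv_le_one_of_one_le₀ hm1)) (inv_nonneg.2 hm0.le) (sub_add_cancel _ _)
    rw [hcomb, smul_eq_mul, smul_eq_mul] at hconv
    have hnorm : ‖l - (m : ℝ) • η‖ ≤ 1 + ‖l‖ := by
      have h1 : ‖(m : ℝ) • η‖ ≤ 1 := by
        rw [norm_smul, Real.norm_of_nonneg hm0.le]
        calc (m : ℝ) * ‖η‖ ≤ m * (1 / m) := by gcongr
          _ = 1 := by field_simp
      have := norm_sub_le l ((m : ℝ) • η)
      linarith
    have hF1 : F t t' (l - (m : ℝ) • η) ≤ c₂ * (1 + B (1 + ‖l‖)) := by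
      refine (hF.upper _ _ _).trans (mul_le_mul_of_nonneg_left ?_ hF.pos_right.le)
      linarith [hB.monotoneOn (norm_nonneg _) (mem_Ici.2 (by positivity)) hnorm]
    have h2 : (m : ℝ)⁻¹ * F t t' (l - (m : ℝ) • η) ≤ (m : ℝ)⁻¹ * (c₂ * (1 + B (1 + ‖l‖))) :=
      mul_le_mul_of_nonneg_left hF1 (inv_nonneg.2 hm0.le)
    have h3 : (1 - (m : ℝ)⁻¹) * F t t' l ≤ F t t' l :=
      mul_le_of_le_one_left (hF.nonneg _ _ _) (by linarith [inv_nonneg.2 hm0.le])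
    rw [hK, div_eq_inv_mul]
    linarith
  have hcl : Continuous fun η => F t t' (l - η) :=
    (hF.continuous t).comp (by fun_prop : Continuous fun η : RSpace d => (t', l - η))
  have hi1 : Integrable fun η => θ η * F t t' (l - η) :=
    (hθ.smooth.continuous.mul hcl).integrable_of_hasCompactSupport hθ.hasCompactSupport.mul_right
  have hi2 : Integrable fun η => θ η * K :=
    (hθ.smooth.continuous.integrable_of_hasCompactSupport hθ.hasCompactSupport).mul_const K
  calc ∫ η, θ η * F t t' (l - η) ≤ ∫ η, θ η * K := integral_mono hi1 hi2 hpt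
    _ = K := by rw [integral_mul_const, hθ.integral_eq_one, one_mul]

end Mollification

lemma MemOrliczPerOn.aestronglyMeasurable {N : ℕ} {B : ℝ → ℝ} {Ω : Set (RSpace N)}
    (hΩ : IsOpen Ω) {u : RSpace N × RSpace N × RSpace N → ℝ} (hu : MemOrliczPerOn B Ω u) :
    AEStronglyMeasurable u (volume.restrict (Ω ×ˢ (unitCube N ×ˢ unitCube N))) := by
  have hD : IsOpen (Ω ×ˢ (unitCube N ×ˢ unitCube N)) :=
    hΩ.prod ((isOpen_unitCube N).prod (isOpen_unitCube N))
  obtain ⟨K, hKc, hKs, hKU, -⟩ := hD.exists_iUnion_isClosed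
  have hU : Ω ×ˢ (unitCube N ×ˢ unitCube N) =
      ⋃ q : ℕ × ℕ, K q.1 ∩ Metric.closedBall 0 (q.2 : ℝ) := by
    rw [← hKU]
    ext p
    simp only [mem_iUnion, Prod.exists, mem_inter_iff, mem_closedBall_zero_iff]
    exact ⟨fun ⟨i, hi⟩ => ⟨i, ⌈‖p‖⌉₊, hi, Nat.le_ceil _⟩, fun ⟨i, _, hi, _⟩ => ⟨i, hi⟩⟩
  rw [hU]
  refine AEStronglyMeasurable.iUnion fun q => (hu.loc _ ?_ ?_).1
  · exact (isCompact_closedBall _ _).inter_left (hKc _)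
  · exact inter_subset_left.trans ((hKs _).trans (prod_mono_right (subset_univ _)))

/-! ### Lower semicontinuity -/

lemma coe_le_liminf_of_tendsto_of_le {u I : ℕ → ℝ} {T : ℝ} (hu : Tendsto u atTop (𝓝 T))
    (h : ∀ k, u k ≤ I k) : (T : EReal) ≤ liminf (fun k => (I k : EReal)) atTop := by
  have h1 : Tendsto (fun k => (u k : EReal)) atTop (𝓝 (T : EReal)) :=
    (continuous_coe_real_ereal.tendsto T).comp hu
  rw [← h1.liminf_eq]
  exact liminf_le_liminf (Eventually.of_forall fun k => EReal.coe_le_coe_iff.2 (h k))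

section LowerSemicontinuity

variable {N d : ℕ} {B : ℝ → ℝ} {Ω : Set (RSpace N)} {ε : ℕ → ℝ} {v : ℕ → RSpace N → RSpace d}
  {v₀ : RSpace N × RSpace N × RSpace N → RSpace d}

lemma isFiniteMeasure_restrict_prod_cubes (hΩf : volume Ω ≠ ⊤) :
    IsFiniteMeasure ((volume : Measure (RSpace N × RSpace N × RSpace N)).restrict
      (Ω ×ˢ (unitCube N ×ˢ unitCube N))) := by
  have : IsFiniteMeasure (volume.restrict Ω) :=
    ⟨by rw [Measure.restrict_apply_univ]; exact hΩf.lt_top⟩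
  rw [volume_restrict_prod_cubes]
  infer_instance

/-- Weak reiterated two-scale convergence tested with the vector fields `H (x, [y], [z]) q`. -/
lemma tendsto_setIntegral_mul_inner (hB : IsNFunction B) (hB2 : DeltaTwo B) (hΩo : IsOpen Ω)
    (hΩf : volume Ω ≠ ⊤)
    (hv : ∀ j, WeakReitTwoScale B Ω ε (fun k x => v k x j) (fun p => v₀ p j))
    (H : BoundedContinuousFunction (RSpace N × Torus N × Torus N) ℝ) (q : RSpace d) :
    Tendsto (fun k => ∫ x in Ω, H (scalePoint (ε k) x) * inner ℝ q (v k x)) atTop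
      (𝓝 (∫ p in Ω ×ˢ (unitCube N ×ˢ unitCube N), H (torusPoint p) * inner ℝ q (v₀ p))) := by
  have : IsFiniteMeasure (volume.restrict Ω) :=
    ⟨by rw [Measure.restrict_apply_univ]; exact hΩf.lt_top⟩
  have := isFiniteMeasure_restrict_prod_cubes hΩf
  have e : ∀ (c : ℝ) (l : RSpace d), c * inner ℝ q l = ∑ j, q j * (l j * c) := by
    intro c l
    rw [PiLp.inner_apply, Finset.mul_sum]
    refine Finset.sum_congr rfl fun j _ => ?_
    simp only [RCLike.inner_apply, conj_trivial]
    ring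
  have hi : ∀ k j, Integrable (fun x => v k x j * H (scalePoint (ε k) x)) (volume.restrict Ω) :=
    fun k j => (hB.integrable ((hv j).mem k).1
      (((hv j).mem k).lintegral_lt_top hB hB2)).mul_bdd
      (H.continuous.comp (continuous_scalePoint _)).aestronglyMeasurable
      (Eventually.of_forall fun x => H.norm_coe_le_norm _)
  have hi₀ : ∀ j, Integrable (fun p => v₀ p j * H (torusPoint p))
      (volume.restrict (Ω ×ˢ (unitCube N ×ˢ unitCube N))) :=
    fun j => (hB.integrable ((hv j).limit_mem.aestronglyMeasurable hΩo)
      (hv j).limit_mem.finite).mul_bdd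
      (H.continuous.comp continuous_torusPoint).aestronglyMeasurable
      (Eventually.of_forall fun x => H.norm_coe_le_norm _)
  simp only [e]
  rw [integral_finsetSum _ fun j _ => (hi₀ j).const_mul _]
  have e2 : ∀ k, ∫ x in Ω, ∑ j, q j * (v k x j * H (scalePoint (ε k) x)) =
      ∑ j, q j * ∫ x in Ω, v k x j * H (scalePoint (ε k) x) := fun k => by
    rw [integral_finsetSum _ fun j _ => (hi k j).const_mul _]
    exact Finset.sum_congr rfl fun j _ => integral_const_mul _ _
  simp only [e2, integral_const_mul]
  refine tendsto_finsetSum _ fun j _ => Tendsto.const_mul _ ?_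
  exact (hv j).tendsto (torusTest H) (memOrliczCPer_torusTest hB hΩf H)

/-- The limit inequality for a finite mixture of local affine minorants: the slopes pass to the
limit by weak two-scale convergence, the constants by the mean value property. -/
lemma IsTorusIntegrand.mixture_le_liminf (hB : IsNFunction B) (hB2 : DeltaTwo B) (hΩo : IsOpen Ω)
    (hΩf : volume Ω ≠ ⊤) (hεpos : ∀ k, 0 < ε k) (hε : Tendsto ε atTop (𝓝 0))
    (hv : ∀ j, WeakReitTwoScale B Ω ε (fun k x => v k x j) (fun p => v₀ p j))
    {F : Torus N → Torus N → RSpace d → ℝ} {c₁ c₂ : ℝ} (hF : IsTorusIntegrand B F c₁ c₂)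
    {ι : Type*} [Fintype ι] (q : ι → RSpace d) (c : ι → Torus N) {r : ι → ℝ} (hr : ∀ i, 0 < r i)
    (H : ι → BoundedContinuousFunction (RSpace N × Torus N × Torus N) ℝ)
    (hH0 : ∀ i p, 0 ≤ H i p) (hH1 : ∀ p, ∑ i, H i p ≤ 1) :
    ((∫ p in Ω ×ˢ (unitCube N ×ˢ unitCube N), ∑ i, H i (torusPoint p) *
        localMinorant F (q i) (c i) (hr i) (toTorus p.2.1) (toTorus p.2.2) (v₀ p) : ℝ) : EReal) ≤
      liminf (fun k => ((∫ x in Ω, F (toTorus ((ε k)⁻¹ • x)) (toTorus (((ε k) ^ 2)⁻¹ • x))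
        (v k x) : ℝ) : EReal)) atTop := by
  have : IsFiniteMeasure (volume.restrict Ω) :=
    ⟨by rw [Measure.restrict_apply_univ]; exact hΩf.lt_top⟩
  have := isFiniteMeasure_restrict_prod_cubes hΩf
  have hbump : ∀ i, ∃ b : BoundedContinuousFunction (RSpace N × Torus N × Torus N) ℝ,
      ∀ p, b p = torusBump (c i) (r i) p.2.2 := fun i =>
    ⟨BoundedContinuousFunction.ofNormedAddCommGroup (fun p => torusBump (c i) (r i) p.2.2)
      ((continuous_torusBump _ _).comp (by fun_prop)) 1 fun p => by
        rw [Real.norm_of_nonneg (torusBump_nonneg _ _ _)]; exact torusBump_le_one _ _ _,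
      fun p => rfl⟩
  choose b hb using hbump
  let G : ι → BoundedContinuousFunction (RSpace N × Torus N × Torus N) ℝ := fun i => H i * b i
  have hG : ∀ i p, G i p = H i p * torusBump (c i) (r i) p.2.2 := fun i p => by
    rw [← hb i p]; rfl
  have hsplit : ∀ i (p : RSpace N × Torus N × Torus N) (l : RSpace d),
      H i p * localMinorant F (q i) (c i) (hr i) p.2.1 p.2.2 l =
        G i p * inner ℝ (q i) l - localConj F (q i) (c i) (hr i) p.2.1 * G i p := fun i p l => by
    rw [hG, localMinorant]; ring
  choose A hA using fun i => hF.exists_abs_localConj_le hB (q i) (c i) (hr i)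
  have ham := fun i => hF.measurable_localConj (q i) (c i) (hr i)
  have hεw : Tendsto ε atTop (𝓝[>] 0) :=
    tendsto_nhdsWithin_iff.2 ⟨hε, Eventually.of_forall hεpos⟩
  have hvint : ∀ k, Integrable (v k) (volume.restrict Ω) := fun k =>
    hB.integrable_of_components hB2 (fun j => ((hv j).mem k).1)
      fun j => ((hv j).mem k).lintegral_lt_top hB hB2
  have hv₀int : Integrable v₀ (volume.restrict (Ω ×ˢ (unitCube N ×ˢ unitCube N))) :=
    hB.integrable_of_components hB2 (fun j => (hv j).limit_mem.aestronglyMeasurable hΩo)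
      fun j => (hv j).limit_mem.finite
  have hlin : ∀ i k, Integrable (fun x => G i (scalePoint (ε k) x) * inner ℝ (q i) (v k x))
      (volume.restrict Ω) := fun i k =>
    ((hvint k).const_inner (q i)).bdd_mul
      ((G i).continuous.comp (continuous_scalePoint _)).aestronglyMeasurable
      (Eventually.of_forall fun x => (G i).norm_coe_le_norm _)
  have hlin₀ : ∀ i, Integrable (fun p => G i (torusPoint p) * inner ℝ (q i) (v₀ p))
      (volume.restrict (Ω ×ˢ (unitCube N ×ˢ unitCube N))) := fun i =>
    (hv₀int.const_inner (q i)).bdd_mul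
      ((G i).continuous.comp continuous_torusPoint).aestronglyMeasurable
      (Eventually.of_forall fun x => (G i).norm_coe_le_norm _)
  have hcst : ∀ i (ρ : ℝ), Integrable (fun x => localConj F (q i) (c i) (hr i) (toTorus (ρ⁻¹ • x)) *
      G i (scalePoint ρ x)) (volume.restrict Ω) := fun i ρ => by
    refine Integrable.bdd_mul (c := A i) ?_
      ((ham i).comp (continuous_toTorus.comp (by fun_prop)).measurable).aestronglyMeasurable
      (Eventually.of_forall fun x => hA i _)
    exact (integrable_const ‖G i‖).mono'
      ((G i).continuous.comp (continuous_scalePoint _)).aestronglyMeasurable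
      (Eventually.of_forall fun x => (G i).norm_coe_le_norm _)
  have hcst₀ : ∀ i, Integrable (fun p : RSpace N × RSpace N × RSpace N =>
      localConj F (q i) (c i) (hr i) (toTorus p.2.1) * G i (torusPoint p))
      (volume.restrict (Ω ×ˢ (unitCube N ×ˢ unitCube N))) := fun i => by
    refine Integrable.bdd_mul (c := A i) ?_
      ((ham i).comp (continuous_toTorus.comp (by fun_prop)).measurable).aestronglyMeasurable
      (Eventually.of_forall fun x => hA i _)
    exact (integrable_const ‖G i‖).mono'
      ((G i).continuous.comp continuous_torusPoint).aestronglyMeasurable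
      (Eventually.of_forall fun x => (G i).norm_coe_le_norm _)
  have hlim : Tendsto (fun k => ∑ i, ((∫ x in Ω, G i (scalePoint (ε k) x) * inner ℝ (q i) (v k x)) -
      ∫ x in Ω, localConj F (q i) (c i) (hr i) (toTorus ((ε k)⁻¹ • x)) *
        G i (scalePoint (ε k) x))) atTop
      (𝓝 (∫ p in Ω ×ˢ (unitCube N ×ˢ unitCube N), ∑ i, H i (torusPoint p) *
        localMinorant F (q i) (c i) (hr i) (toTorus p.2.1) (toTorus p.2.2) (v₀ p))) := by
    have h1 : ∫ p in Ω ×ˢ (unitCube N ×ˢ unitCube N), ∑ i, H i (torusPoint p) *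
        localMinorant F (q i) (c i) (hr i) (toTorus p.2.1) (toTorus p.2.2) (v₀ p) =
        ∑ i, ((∫ p in Ω ×ˢ (unitCube N ×ˢ unitCube N),
          G i (torusPoint p) * inner ℝ (q i) (v₀ p)) -
          ∫ p in Ω ×ˢ (unitCube N ×ˢ unitCube N),
            localConj F (q i) (c i) (hr i) (toTorus p.2.1) * G i (torusPoint p)) := by
      have h2 : ∀ p : RSpace N × RSpace N × RSpace N, ∑ i, H i (torusPoint p) *
          localMinorant F (q i) (c i) (hr i) (toTorus p.2.1) (toTorus p.2.2) (v₀ p) =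
          ∑ i, (G i (torusPoint p) * inner ℝ (q i) (v₀ p) -
            localConj F (q i) (c i) (hr i) (toTorus p.2.1) * G i (torusPoint p)) := fun p =>
        Finset.sum_congr rfl fun i _ => hsplit i (torusPoint p) (v₀ p)
      simp only [h2]
      exact (integral_finsetSum _ fun i _ => (hlin₀ i).sub (hcst₀ i)).trans
        (Finset.sum_congr rfl fun i _ => integral_sub (hlin₀ i) (hcst₀ i))
    rw [h1]
    refine tendsto_finsetSum _ fun i _ => Tendsto.sub ?_ ?_
    · exact tendsto_setIntegral_mul_inner hB hB2 hΩo hΩf hv (G i) (q i)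
    · exact (tendsto_setIntegral_mul_scalePoint hΩo.measurableSet hΩf (ham i) (hA i) (G i)).comp hεw
  refine coe_le_liminf_of_tendsto_of_le hlim fun k => ?_
  have h3 : ∑ i, ((∫ x in Ω, G i (scalePoint (ε k) x) * inner ℝ (q i) (v k x)) -
      ∫ x in Ω, localConj F (q i) (c i) (hr i) (toTorus ((ε k)⁻¹ • x)) *
        G i (scalePoint (ε k) x)) =
      ∫ x in Ω, ∑ i, (G i (scalePoint (ε k) x) * inner ℝ (q i) (v k x) -
        localConj F (q i) (c i) (hr i) (toTorus ((ε k)⁻¹ • x)) * G i (scalePoint (ε k) x)) := by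
    exact ((integral_finsetSum _ fun i _ => (hlin i k).sub (hcst i (ε k))).trans
      (Finset.sum_congr rfl fun i _ => integral_sub (hlin i k) (hcst i (ε k)))).symm
  rw [h3]
  refine integral_mono (integrable_finsetSum _ fun i _ => (hlin i k).sub (hcst i (ε k)))
    (hF.integrable_comp hB hB2 (continuous_toTorus.comp (by fun_prop)).measurable
      (continuous_toTorus.comp (by fun_prop)).measurable (fun j => ((hv j).mem k).1)
      fun j => ((hv j).mem k).lintegral_lt_top hB hB2) fun x => ?_
  calc ∑ i, (G i (scalePoint (ε k) x) * inner ℝ (q i) (v k x) -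
        localConj F (q i) (c i) (hr i) (toTorus ((ε k)⁻¹ • x)) * G i (scalePoint (ε k) x))
      = ∑ i, H i (scalePoint (ε k) x) * localMinorant F (q i) (c i) (hr i)
          (toTorus ((ε k)⁻¹ • x)) (toTorus (((ε k) ^ 2)⁻¹ • x)) (v k x) :=
        Finset.sum_congr rfl fun i _ => (hsplit i (scalePoint (ε k) x) (v k x)).symm
    _ ≤ ∑ i, H i (scalePoint (ε k) x) *
          F (toTorus ((ε k)⁻¹ • x)) (toTorus (((ε k) ^ 2)⁻¹ • x)) (v k x) :=
        Finset.sum_le_sum fun i _ => mul_le_mul_of_nonneg_left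
          (hF.localMinorant_le hB _ _ _ _ _ _) (hH0 i _)
    _ ≤ F (toTorus ((ε k)⁻¹ • x)) (toTorus (((ε k) ^ 2)⁻¹ • x)) (v k x) := by
        rw [← Finset.sum_mul]
        exact mul_le_of_le_one_left (hF.nonneg _ _ _) (hH1 _)

/-- Lower semicontinuity of the integral functional under weak reiterated two-scale convergence. -/
lemma IsTorusIntegrand.integral_le_liminf (hB : IsNFunction B) (hB2 : DeltaTwo B) (hΩo : IsOpen Ω)
    (hΩf : volume Ω ≠ ⊤) (hεpos : ∀ k, 0 < ε k) (hε : Tendsto ε atTop (𝓝 0))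
    (hv : ∀ j, WeakReitTwoScale B Ω ε (fun k x => v k x j) (fun p => v₀ p j))
    {F : Torus N → Torus N → RSpace d → ℝ} {c₁ c₂ : ℝ} (hF : IsTorusIntegrand B F c₁ c₂) :
    ((∫ p in Ω ×ˢ (unitCube N ×ˢ unitCube N), F (toTorus p.2.1) (toTorus p.2.2) (v₀ p) : ℝ) :
      EReal) ≤ liminf (fun k => ((∫ x in Ω, F (toTorus ((ε k)⁻¹ • x))
        (toTorus (((ε k) ^ 2)⁻¹ • x)) (v k x) : ℝ) : EReal)) atTop := by
  have := isFiniteMeasure_restrict_prod_cubes hΩf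
  set D : Set (RSpace N × RSpace N × RSpace N) := Ω ×ˢ (unitCube N ×ˢ unitCube N) with hD
  have hm := fun j => (hv j).limit_mem.aestronglyMeasurable hΩo
  have hFi : IntegrableOn (fun p => F (toTorus p.2.1) (toTorus p.2.2) (v₀ p)) D :=
    hF.integrable_comp hB hB2 (continuous_toTorus.comp (by fun_prop)).measurable
      (continuous_toTorus.comp (by fun_prop)).measurable hm fun j => (hv j).limit_mem.finite
  let q : ℕ → RSpace d := fun n =>
    TopologicalSpace.denseSeq (RSpace d) (Denumerable.ofNat (ℕ × ℕ × ℕ) n).1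
  let c : ℕ → Torus N := fun n =>
    TopologicalSpace.denseSeq (Torus N) (Denumerable.ofNat (ℕ × ℕ × ℕ) n).2.1
  have hr : ∀ n : ℕ, (0 : ℝ) < 1 / (((Denumerable.ofNat (ℕ × ℕ × ℕ) n).2.2 : ℝ) + 1) := fun n =>
    Nat.one_div_pos_of_nat
  let h : ℕ → RSpace N × RSpace N × RSpace N → ℝ := fun n p =>
    localMinorant F (q n) (c n) (hr n) (toTorus p.2.1) (toTorus p.2.2) (v₀ p)
  have hhF : ∀ n p, h n p ≤ F (toTorus p.2.1) (toTorus p.2.2) (v₀ p) := fun n p =>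
    hF.localMinorant_le hB _ _ _ _ _ _
  have hv₀int : Integrable v₀ (volume.restrict D) :=
    hB.integrable_of_components hB2 hm fun j => (hv j).limit_mem.finite
  have hhi : ∀ n, IntegrableOn (h n) D := by
    intro n
    obtain ⟨A, hA⟩ := hF.exists_abs_localConj_le hB (q n) (c n) (hr n)
    have ha : Integrable (fun p : RSpace N × RSpace N × RSpace N =>
        localConj F (q n) (c n) (hr n) (toTorus p.2.1)) (volume.restrict D) :=
      (integrable_const A).mono' ((hF.measurable_localConj (q n) (c n) (hr n)).comp
        (continuous_toTorus.comp (by fun_prop)).measurable).aestronglyMeasurable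
        (Eventually.of_forall fun p => hA _)
    refine ((hv₀int.const_inner (q n)).sub ha).bdd_mul (c := 1)
      ((continuous_torusBump _ _).comp
        (continuous_toTorus.comp (by fun_prop))).aestronglyMeasurable
      (Eventually.of_forall fun p => ?_)
    rw [Real.norm_of_nonneg (torusBump_nonneg _ _ _)]
    exact torusBump_le_one _ _ _
  let M : ℕ → RSpace N × RSpace N × RSpace N → ℝ := fun n p => partialSups (fun i => h i p) n
  have hMi : ∀ n, IntegrableOn (M n) D := by
    intro n
    induction n with
    | zero => simpa only [M, partialSups_zero] using hhi 0
    | succ n ih =>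
      have e : M (n + 1) = fun p => M n p ⊔ h (n + 1) p := by
        ext p; exact partialSups_add_one _ _
      rw [e]
      exact ih.sup (hhi (n + 1))
  have hlim : Tendsto (fun n => ∫ p in D, M n p) atTop
      (𝓝 (∫ p in D, F (toTorus p.2.1) (toTorus p.2.2) (v₀ p))) := by
    refine integral_tendsto_of_tendsto_of_monotone hMi hFi
      (Eventually.of_forall fun p => (partialSups fun i => h i p).monotone)
      (Eventually.of_forall fun p => tendsto_order.2 ⟨fun a ha => ?_, fun a ha => ?_⟩)
    · obtain ⟨i, j, k, hijk⟩ := hF.exists_lt_localMinorant hB (toTorus p.2.1) (toTorus p.2.2) (v₀ p)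
        (sub_pos.2 ha)
      rw [sub_sub_cancel] at hijk
      have hn : a < h (Encodable.encode (i, j, k)) p := by
        simp only [h, q, c]
        convert! hijk using 2 <;> simp
      filter_upwards [eventually_ge_atTop (Encodable.encode (i, j, k))] with n hin
      exact hn.trans_le (le_partialSups_of_le (fun i => h i p) hin)
    · exact Eventually.of_forall fun n => (partialSups_le _ _ _ fun i _ => hhF i p).trans_lt ha
  have key : ∀ ℓ : ℝ, liminf (fun k => ((∫ x in Ω, F (toTorus ((ε k)⁻¹ • x))
        (toTorus (((ε k) ^ 2)⁻¹ • x)) (v k x) : ℝ) : EReal)) atTop ≤ ℓ →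
      ∫ p in D, F (toTorus p.2.1) (toTorus p.2.2) (v₀ p) ≤ ℓ := by
    intro ℓ hℓ
    refine le_of_tendsto' hlim fun n => ?_
    refine integral_le_of_forall_mixture_le hΩo.measurableSet (ι := Fin (n + 1))
      (h := fun i => h i) (fun i => hhi i) (fun H hH0 hH1 => ?_) (hMi n) fun p => Or.inr ?_
    · have := (hF.mixture_le_liminf hB hB2 hΩo hΩf hεpos hε hv (fun i : Fin (n + 1) => q i)
        (fun i => c i) (fun i => hr i) H hH0 hH1).trans hℓ
      exact EReal.coe_le_coe_iff.1 this
    · obtain ⟨i, hi, hin⟩ := exists_partialSups_eq (fun i => h i p) n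
      exact ⟨⟨i, Nat.lt_succ_of_le hi⟩, hin.le⟩
  refine EReal.le_of_forall_lt_iff_le.1 fun ℓ hℓ => ?_
  exact EReal.coe_le_coe_iff.2 (key ℓ hℓ.le)

end LowerSemicontinuity

/-! ### The limit inequality for the mollified integrands -/

theorem proposition3p2 (n N : ℕ) (B : ℝ → ℝ) (hB : IsNFunction B) (hB2 : DeltaTwo B)
    (hBc2 : DeltaTwo (complementaryFun B))
    (Ω : Set (RSpace N)) (hΩo : IsOpen Ω) (hΩb : Bornology.IsBounded Ω)
    (f : RSpace N → RSpace N → RSpace (n * N) → ℝ) (hf : IsIntegrand B f)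
    (θ : ℕ → RSpace (n * N) → ℝ) (hθ : ∀ m, 1 ≤ m → IsSymmMollifier m (θ m))
    (ε : ℕ → ℝ) (hεpos : ∀ k, 0 < ε k) (hε : Tendsto ε atTop (𝓝 0))
    (v : ℕ → RSpace N → RSpace (n * N))
    (v₀ : RSpace N × RSpace N × RSpace N → RSpace (n * N))
    (hv : ∀ j, WeakReitTwoScale B Ω ε (fun k x => v k x j) (fun p => v₀ p j)) :
    (∀ k, IntegrableOn (fun x => f ((ε k)⁻¹ • x) (((ε k) ^ 2)⁻¹ • x) (v k x)) Ω) ∧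
    (∀ m, 1 ≤ m → IntegrableOn
      (fun p : RSpace N × RSpace N × RSpace N =>
        mollifiedIntegrand (θ m) f p.2.1 p.2.2 (v₀ p)) (Ω ×ˢ (unitCube N ×ˢ unitCube N))) ∧
    ∃ C' : ℝ, ∀ m : ℕ, 1 ≤ m →
      (((∫ p in Ω ×ˢ (unitCube N ×ˢ unitCube N),
          mollifiedIntegrand (θ m) f p.2.1 p.2.2 (v₀ p)) - C' / m : ℝ) : EReal) ≤
        liminf (fun k =>
          ((∫ x in Ω, f ((ε k)⁻¹ • x) (((ε k) ^ 2)⁻¹ • x) (v k x) : ℝ) : EReal)) atTop := by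
  have hΩf : volume Ω ≠ ⊤ := hΩb.measure_lt_top.ne
  have : IsFiniteMeasure (volume.restrict Ω) :=
    ⟨by rw [Measure.restrict_apply_univ]; exact hΩf.lt_top⟩
  have := isFiniteMeasure_restrict_prod_cubes hΩf
  obtain ⟨F, c₁, c₂, hF, hfF⟩ := exists_isTorusIntegrand hB hf
  set D : Set (RSpace N × RSpace N × RSpace N) := Ω ×ˢ (unitCube N ×ˢ unitCube N) with hD
  have hmk := fun k j => ((hv j).mem k).1
  have hfk := fun k j => ((hv j).mem k).lintegral_lt_top hB hB2
  have hm₀ := fun j => (hv j).limit_mem.aestronglyMeasurable hΩo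
  have hf₀ := fun j => (hv j).limit_mem.finite
  -- replacing `f` by `F` changes the integrands on null sets only
  have haek : ∀ k, (fun x => F (toTorus ((ε k)⁻¹ • x)) (toTorus (((ε k) ^ 2)⁻¹ • x)) (v k x))
      =ᵐ[volume.restrict Ω] fun x => f ((ε k)⁻¹ • x) (((ε k) ^ 2)⁻¹ • x) (v k x) := fun k => by
    refine ae_restrict_of_ae ?_
    filter_upwards [(Measure.quasiMeasurePreserving_smul volume
      (inv_ne_zero (hεpos k).ne')).ae hfF] with x hx
    exact (hx _ _).symm
  have haey : ∀ᵐ p : RSpace N × RSpace N × RSpace N ∂(volume.restrict D),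
      ∀ z l, f p.2.1 z l = F (toTorus p.2.1) (toTorus z) l := by
    refine ae_restrict_of_ae ?_
    exact (Measure.quasiMeasurePreserving_fst.comp
      (Measure.quasiMeasurePreserving_snd (μ := (volume : Measure (RSpace N)))
        (ν := (volume : Measure (RSpace N × RSpace N))))).ae hfF
  have hae : ∀ m, (fun p : RSpace N × RSpace N × RSpace N =>
      ∫ η, θ m η * F (toTorus p.2.1) (toTorus p.2.2) (v₀ p - η)) =ᵐ[volume.restrict D]
      fun p => mollifiedIntegrand (θ m) f p.2.1 p.2.2 (v₀ p) := fun m => by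
    filter_upwards [haey] with p hp
    simp only [mollifiedIntegrand, hp]
  have hBi : Integrable (fun p => c₂ * (1 + B (1 + ‖v₀ p‖))) (volume.restrict D) :=
    ((integrable_const 1).add (hB.integrable_one_add_norm hB2 hm₀ hf₀)).const_mul c₂
  have hFi : Integrable (fun p => F (toTorus p.2.1) (toTorus p.2.2) (v₀ p)) (volume.restrict D) :=
    hF.integrable_comp hB hB2 (continuous_toTorus.comp (by fun_prop)).measurable
      (continuous_toTorus.comp (by fun_prop)).measurable hm₀ hf₀
  have hmoll : ∀ m, 1 ≤ m → Integrable (fun p : RSpace N × RSpace N × RSpace N =>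
      ∫ η, θ m η * F (toTorus p.2.1) (toTorus p.2.2) (v₀ p - η)) (volume.restrict D) := by
    intro m hm
    refine (hFi.add (hBi.div_const m)).mono' ?_ (Eventually.of_forall fun p => ?_)
    · exact ((hF.measurable_mollified (hθ m hm)).comp_aemeasurable
        ((continuous_toTorus.comp (by fun_prop)).measurable.aemeasurable.prodMk
          ((continuous_toTorus.comp (by fun_prop)).measurable.aemeasurable.prodMk
            (aestronglyMeasurable_of_components hm₀).aemeasurable))).aestronglyMeasurable
    · rw [Real.norm_of_nonneg (hF.mollified_nonneg (hθ m hm) _ _ _)]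
      exact hF.mollified_le hB hm (hθ m hm) _ _ _
  refine ⟨fun k => ?_, fun m hm => (hmoll m hm).congr (hae m),
    ∫ p in D, c₂ * (1 + B (1 + ‖v₀ p‖)), fun m hm => ?_⟩
  · exact (hF.integrable_comp hB hB2 (continuous_toTorus.comp (by fun_prop)).measurable
      (continuous_toTorus.comp (by fun_prop)).measurable (hmk k) (hfk k)).congr (haek k)
  · have hle : (∫ p in D, mollifiedIntegrand (θ m) f p.2.1 p.2.2 (v₀ p)) -
        (∫ p in D, c₂ * (1 + B (1 + ‖v₀ p‖))) / m ≤
        ∫ p in D, F (toTorus p.2.1) (toTorus p.2.2) (v₀ p) := by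
      rw [sub_le_iff_le_add, ← integral_congr_ae (hae m), ← integral_div,
        ← integral_add hFi (hBi.div_const m)]
      exact integral_mono (hmoll m hm) (hFi.add (hBi.div_const m))
        fun p => hF.mollified_le hB hm (hθ m hm) _ _ _
    refine (EReal.coe_le_coe_iff.2 hle).trans ?_
    have h := hF.integral_le_liminf hB hB2 hΩo hΩf hεpos hε hv
    simpa only [fun k => integral_congr_ae (haek k)] using h
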